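/- **Parameters.** Fix a base type $b\in\{\mathsf{bool},\mathsf{int}\}$ and, for each $k\ge 0$, a set of symbols $\mathsf{op}_k$, each denoting a function $[\![\mathsf{op}_k]\!]$ from $k$-tuples of constants of type $b$ to constants of type $b$. For $b=\mathsf{int}$, "true" means non-zero and "false" means $0$. **Source language $\mathrm{PCF}^{\mathrm{lin}}_{\mathrm{ref}}(b)$.** Types are $\rho::=b\mid \mathsf{ref}\,\rho$ (base and reference types), $\tau::=\mathsf{unit}\mid\rho\mid\tau_1\xrightarrow{n}\tau_2$ with $n\in\mathbb N$ (normal types), $\sigma::=\tau\mid\tau_1\xrightarrow{\Delta}\tau_2$ (full types), where $\Delta=x_1{:}\tau_1,\dots,x_k{:}\tau_k$ is a normal type environment; a (full) type environment is a sequence $\Gamma=x_1{:}\sigma_1,\dots,x_k{:}\sigma_k$. The variables in an environment are mutually different. Every variable is annotated with its type ($x^\sigma$). Terms are $$M::=\mathsf{FAIL}\mid ()\mid c\mid x\mid \mathsf{op}_k(x_1,\dots,x_k)\mid\, !x\mid\mathsf{mkref}\,x\mid y:=x\mid\mathsf{let}\,x=M_1\,\mathsf{in}\,M_2\mid\mathsf{if}\,x\,\mathsf{then}\,M_1\,\mathsf{else}\,M_2\mid\lambda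 x.M\mid\mathsf{fix}(f,x,M)\mid f\,x .$$ Base types are $\mathsf{unit}$ and $b$. The sharable types are $\mathsf{unit}$, $b$ and $\tau_1\xrightarrow{0}\tau_2$. $\Gamma\setminus x$ removes the binding of $x$; $\Gamma\ominus_\sigma x$ is $\Gamma$ if $\sigma$ is sharable and $\Gamma\setminus x$ otherwise; $\Gamma\ominus x=\Gamma\ominus_{\Gamma(x)}x$. $\mathrm{split}(\Gamma,S)=(\Gamma_1,\Gamma_2)$, where $\Gamma_1$ consists of the bindings of variables in $S$ and $\Gamma_2$ of the bindings of variables that are not in $S$ or have sharable type. Sizes: $|\mathsf{unit}|=|b|=0$, $|\mathsf{ref}\,\rho|=1$, $|\tau_1\xrightarrow{n}\tau_2|=n$, and $|\Delta|$ is the sum over its bindings. **Target language $\mathrm{PCF}(b)$** (pure, call-by-value, with tuples): $N::=\mathsf{FAIL}\mid()\mid c\mid x\mid\mathsf{op}_k(x_1,\dots,x_k)\mid(N_1,\dots,N_k)\mid N.j\mid\mathsf{let}\,x=N_1\,\mathsf{in}\,N_2\mid\mathsf{if}\,x\,\mathsf{then}\,N_1\,\mathsf{else}\,N_2\mid\lambda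 x.N\mid\mathsf{fix}(f,x,N)\mid f\,N$. Pattern bindings such as $\mathsf{let}\,(x,y)=N_1\,\mathsf{in}\,N_2$ and $\lambda(x,y).N$ abbreviate bindings of the projections. A closure is the pair $\langle N\rangle_{h}:=(h,N)$ of its local store and its code; for a variable $f$, $f.\mathsf{env}$ and $f.\mathsf{code}$ denote its first and second component. $\mathrm{pack}_\Gamma$ is the flat tuple that lists, in the order of $\Gamma$, $x$ for each $x{:}\mathsf{ref}\,\rho$ and the $n$ components of $f.\mathsf{env}$ for each $f{:}\tau_1\xrightarrow{n}\tau_2$ in $\Gamma$ (other bindings contribute nothing). $\mathrm{unpack}_\Gamma\,h\,\mathsf{in}\,N$ conversely rebinds, from the successive components of the tuple $h$, each such $x$, and each such $f$ with $n>0$ to $\langle f.\mathsf{code}\rangle_{u}$ where $u$ is the tuple of the corresponding $n$ components, and then continues with $N$. **Translation.** $\Gamma\vdash M:\tau\dashv\Gamma'\leadsto N$ is the least relation closed under the following rules ($h,h',r$ fresh; omitting "$\leadsto N$" gives the typing rules). In every judgment $\Delta$ is required to be a subsequence of $\Gamma$ whenever some $f:\tau_1\xrightarrow{\Delta}\tau_2$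 occurs in $\Gamma$. - $\Gamma\vdash\mathsf{FAIL}:\tau\dashv\Gamma\leadsto(\mathsf{FAIL},\mathrm{pack}_\Gamma)$ for $\tau$ a base type; $\Gamma\vdash():\mathsf{unit}\dashv\Gamma\leadsto((),\mathrm{pack}_\Gamma)$; $\Gamma\vdash c:b\dashv\Gamma\leadsto(c,\mathrm{pack}_\Gamma)$. - If $\Gamma(x)=\tau$: $\Gamma\vdash x:\tau\dashv\Gamma\ominus x\leadsto(x,\mathrm{pack}_{\Gamma\ominus x})$. - If $\Gamma(x_i)=b$ for all $i$: $\Gamma\vdash\mathsf{op}_k(\vec x):b\dashv\Gamma\leadsto(\mathsf{op}_k(\vec x),\mathrm{pack}_\Gamma)$. - If $\Gamma(x)=\mathsf{ref}\,\rho$: $\Gamma\vdash\,!x:\rho\dashv\Gamma'\leadsto(x,\mathrm{pack}_{\Gamma'})$ with $\Gamma'=\Gamma\ominus_\rho x$. - If $\Gamma(x)=\rho$: $\Gamma\vdash\mathsf{mkref}\,x:\mathsf{ref}\,\rho\dashv\Gamma\ominus x\leadsto(x,\mathrm{pack}_{\Gamma\ominus x})$. - If $\Gamma(y)=\mathsf{ref}\,\rho$,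 $\Gamma(x)=\rho$: $\Gamma\vdash y:=x:\mathsf{unit}\dashv\Gamma\ominus x\leadsto\mathsf{let}\,y=x\,\mathsf{in}\,((),\mathrm{pack}_{\Gamma\ominus x})$. - If $\Gamma\vdash M_1:\tau'\dashv\Gamma''\leadsto N_1$ and $\Gamma'',x{:}\tau'\vdash M_2:\tau\dashv\Gamma'\leadsto N_2$: $\Gamma\vdash\mathsf{let}\,x=M_1\,\mathsf{in}\,M_2:\tau\dashv\Gamma'\setminus x\leadsto\mathsf{let}\,(x,h)=N_1\,\mathsf{in}\,\mathrm{unpack}_{\Gamma''}\,h\,\mathsf{in}\,N_2$. - If $\Gamma(x)=b$ and $\Gamma\vdash M_i:\tau\dashv\Gamma'\leadsto N_i$ ($i=1,2$): $\Gamma\vdash\mathsf{if}\,x\,\mathsf{then}\,M_1\,\mathsf{else}\,M_2:\tau\dashv\Gamma'\leadsto\mathsf{if}\,x\,\mathsf{then}\,N_1\,\mathsf{else}\,N_2$. - If $(\Delta,\Gamma')=\mathrm{split}(\Gamma,\mathrm{FV}(\lambda x.M))$ and $\Delta,x{:}\tau_1\vdash M:\tau_2\dashv\Delta,x{:}\tau_1\leadsto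 N$: $\Gamma\vdash\lambda x.M:\tau_1\xrightarrow{|\Delta|}\tau_2\dashv\Gamma'\leadsto(\langle\lambda(x,h).\,\mathrm{unpack}_\Delta\,h\,\mathsf{in}\,\mathsf{let}\,(r,h')=N\,\mathsf{in}\,\mathrm{unpack}_{\Delta,x:\tau_1}\,h'\,\mathsf{in}\,(r,x,\mathrm{pack}_\Delta)\rangle_{\mathrm{pack}_\Delta},\mathrm{pack}_{\Gamma'})$. - If $(\Delta,\Gamma')=\mathrm{split}(\Gamma,\mathrm{FV}(\mathsf{fix}(f,x,M)))$ and $\Theta\vdash M:\tau_2\dashv\Theta\leadsto N$ for $\Theta=\Delta,f{:}\tau_1\xrightarrow{\Delta}\tau_2,x{:}\tau_1$: $\Gamma\vdash\mathsf{fix}(f,x,M):\tau_1\xrightarrow{|\Delta|}\tau_2\dashv\Gamma'\leadsto(\langle\mathsf{fix}(f,(x,h),\mathrm{unpack}_\Delta\,h\,\mathsf{in}\,\mathsf{let}\,(r,h')=N\,\mathsf{in}\,\mathrm{unpack}_{\Theta}\,h'\,\mathsf{in}\,(r,x,\mathrm{pack}_\Delta))\rangle_{\mathrm{pack}_\Delta},\mathrm{pack}_{\Gamma'})$.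 - If $\Gamma(f)=\tau_1\xrightarrow{m}\tau_2$, $\Gamma(x)=\tau_1$: $\Gamma\vdash f\,x:\tau_2\dashv\Gamma\leadsto\mathsf{let}\,(r,x,h)=f.\mathsf{code}\,(x,f.\mathsf{env})\,\mathsf{in}\,\mathsf{let}\,f=\langle f.\mathsf{code}\rangle_{h}\,\mathsf{in}\,(r,\mathrm{pack}_\Gamma)$. - If $\Gamma(f)=\tau_1\xrightarrow{\Delta}\tau_2$, $\Gamma(x)=\tau_1$ and $\Delta$ is a subsequence of $\Gamma\setminus\{f,x\}$: $\Gamma\vdash f\,x:\tau_2\dashv\Gamma\leadsto\mathsf{let}\,h=\mathrm{pack}_\Delta\,\mathsf{in}\,\mathsf{let}\,(r,x,h')=f(x,h)\,\mathsf{in}\,\mathrm{unpack}_\Delta\,h'\,\mathsf{in}\,(r,\mathrm{pack}_\Gamma)$. **Big-step semantics.** Source values are constants (including $()$), locations, and closures $\langle\lambda x.M\rangle_R$, $\langle\mathsf{fix}(f,x,M)\rangle_R$; an environment $R$ maps variables to values and a heap $H$ maps locations to constants and locations. $(M,R,H)\Downarrow(v,R',H')$ or $(M,R,H)\Downarrow\mathsf{FAIL}$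 is the standard call-by-value evaluation with lexical scoping, a fresh location for each $\mathsf{mkref}$, and left-to-right propagation of $\mathsf{FAIL}$, in which the environment is updated as the type environment is: $x$ and $\mathsf{mkref}\,x$ and $y:=x$ remove $x$ from $R$ unless its type is sharable; $!x$ with $x$ of type $\mathsf{ref}\,\rho$ removes $x$ unless $\rho$ is sharable; a function $F$ captures $R$ restricted to $\mathrm{FV}(F)$ and leaves the bindings of variables that are not in $\mathrm{FV}(F)$ or have sharable type; $\mathsf{let}\,x=M_1\,\mathsf{in}\,M_2$ removes $x$ at the end; $f\,x$ leaves $R$ unchanged. For the target, $(N,S)\Downarrow w$ or $(N,S)\Downarrow\mathsf{FAIL}$ is the standard call-by-value evaluation with environments $S$ and closures, without a heap. **Theorem.** Let $\tau$ be a base type, $M$ a (necessarily closed) source term and $N$ a target term with $\varepsilon\vdash M:\tau\dashv\varepsilon\leadsto N$, where $\varepsilon$ is the empty type environment. Then $$(M,\emptyset,\emptyset)\Downarrow\mathsf{FAIL}\quad\text{if and only if}\quad(N,\emptyset)\Downarrow\mathsf{FAIL}.$$ -/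

import Mathlib

namespace LinRef

/-! ### Parameters: the base type and its operations -/

/-- The base type `b`, either `bool` or `int`. -/
inductive BaseTy where
  | bool
  | int

/-- The constants of the base type. -/
def BaseTy.Carrier : BaseTy → Type
  | .bool => Bool
  | .int => ℤ

/-- Constants counting as `true` in conditionals; for integers, the non-zero ones. -/
def BaseTy.Truthy : (b : BaseTy) → b.Carrier → Prop
  | .bool, c => c = true
  | .int, c => c ≠ (0 : ℤ)

/-- The language parameters: the base type `b`, the symbols for `k`-ary operations on constants
of type `b`, and the mathematical function denoted by each symbol. -/
structure Lang where
  base : BaseTy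
  Op : ℕ → Type
  sem : {k : ℕ} → Op k → (Fin k → base.Carrier) → base.Carrier

/-! ### Types of the source language -/

/-- Base and reference types `ρ ::= b | ref ρ`. -/
inductive RTy where
  | base
  | ref (ρ : RTy)
  deriving DecidableEq

/-- Normal types `τ ::= unit | ρ | τ₁ →ⁿ τ₂`. -/
inductive NTy where
  | unit
  | r (ρ : RTy)
  | fn (τ₁ : NTy) (n : ℕ) (τ₂ : NTy)
  deriving DecidableEq

/-- Full types `σ ::= τ | τ₁ →^Δ τ₂`, with `Δ` a normal type environment, that is, a sequence of
bindings of names to normal types. -/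
inductive FTy where
  | n (τ : NTy)
  | rfun (τ₁ : NTy) (Δ : List (ℕ × NTy)) (τ₂ : NTy)
  deriving DecidableEq

/-- The type of a value of base type `b`, as a normal type. -/
abbrev NTy.b : NTy := .r .base

/-- Base types: `unit` and `b`. -/
def NTy.IsBase (τ : NTy) : Prop := τ = .unit ∨ τ = .b

/-- Types of sharable values: base types and `τ₁ →⁰ τ₂`. -/
def FTy.sharable : FTy → Bool
  | .n .unit => true
  | .n (.r .base) => true
  | .n (.fn _ 0 _) => true
  | _ => false

/-- Number of base values held in a cell with contents of type `ρ`. -/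
def RTy.cellSize : RTy → ℕ
  | .base => 1
  | .ref ρ => ρ.cellSize

/-- `|τ|`, the size of the store owned by a value of type `τ`. -/
def NTy.size : NTy → ℕ
  | .unit => 0
  | .r .base => 0
  | .r (.ref ρ) => ρ.cellSize
  | .fn _ n _ => n

/-! ### Variables and type environments -/

/-- A variable `x^σ`: every variable carries its type (Church style). -/
structure Var where
  name : ℕ
  ty : FTy
  deriving DecidableEq

/-- The variable `x^τ` given by a binding `x : τ` of a normal type environment. -/
def Var.ofBinding (p : ℕ × NTy) : Var := ⟨p.1, .n p.2⟩

/-- Normal type environments `Δ = x₁ : τ₁, …, x_k : τ_k`. -/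
abbrev NTEnv := List (ℕ × NTy)

/-- Full type environments `Γ = x₁ : σ₁, …, x_k : σ_k`. A binding `x : σ` is the annotated
variable `x^σ`, so that `Γ(x) = σ` reads `x ∈ Γ ∧ x.ty = σ`. -/
abbrev TEnv := List Var

/-- A normal type environment as a full one. -/
def NTEnv.toTEnv (Δ : NTEnv) : TEnv := Δ.map Var.ofBinding

/-- `|Δ|`, the sum of the sizes of the bindings. -/
def NTEnv.size (Δ : NTEnv) : ℕ := (Δ.map fun p => p.2.size).sum

namespace TEnv

/-- `Γ(x) = σ`. -/
def Has (Γ : TEnv) (x : Var) (σ : FTy) : Prop := x ∈ Γ ∧ x.ty = σ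

/-- `Γ ∖ x`. -/
def erase (Γ : TEnv) (x : Var) : TEnv := Γ.filter (· ≠ x)

/-- `Γ` with the binding of `x` removed unless `σ` is sharable. -/
def excTy (Γ : TEnv) (x : Var) (σ : FTy) : TEnv := if σ.sharable then Γ else Γ.erase x

/-- `Γ` with the binding of `x` removed unless the type of `x` is sharable. -/
def exc (Γ : TEnv) (x : Var) : TEnv := Γ.excTy x x.ty

/-- The two components of `splitTE(Γ, S)`: the bindings of variables in `S`, and those of
variables outside `S` or of sharable type. -/
def split (Γ : TEnv) (S : Finset Var) : TEnv × TEnv :=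
  (Γ.filter (· ∈ S), Γ.filter fun x => x ∉ S ∨ x.ty.sharable)

/-- Well-formedness of the pre-environment of a judgment: the variables are mutually different,
and `Δ` is a subsequence of `Γ` whenever `f : τ₁ →^Δ τ₂` occurs in `Γ`. -/
def WF (Γ : TEnv) : Prop :=
  Γ.Nodup ∧ ∀ f ∈ Γ, ∀ τ₁ Δ τ₂, f.ty = .rfun τ₁ Δ τ₂ → (NTEnv.toTEnv Δ).Sublist Γ

end TEnv

/-! ### Source terms -/

/-- Terms of the source language. -/
inductive Term (L : Lang) where
  | fail
  | unit
  | const (c : L.base.Carrier)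
  | var (x : Var)
  | op {k : ℕ} (o : L.Op k) (xs : Fin k → Var)
  | deref (x : Var)
  | mkref (x : Var)
  /-- `assign y x` is `y := x`. -/
  | assign (y x : Var)
  /-- `letE x M₁ M₂` is `let x = M₁ in M₂`. -/
  | letE (x : Var) (M₁ M₂ : Term L)
  | ite (x : Var) (M₁ M₂ : Term L)
  | lam (x : Var) (M : Term L)
  /-- `fix f x M` is the recursive function `f` with `f(x) = M`. -/
  | fix (f x : Var) (M : Term L)
  | app (f x : Var)

/-- Free variables. -/
def Term.FV {L : Lang} : Term L → Finset Var
  | .fail => ∅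
  | .unit => ∅
  | .const _ => ∅
  | .var x => {x}
  | .op _ xs => Finset.univ.image xs
  | .deref x => {x}
  | .mkref x => {x}
  | .assign y x => {y, x}
  | .letE x M₁ M₂ => M₁.FV ∪ (M₂.FV \ {x})
  | .ite x M₁ M₂ => {x} ∪ M₁.FV ∪ M₂.FV
  | .lam x M => M.FV \ {x}
  | .fix f x M => M.FV \ {f, x}
  | .app f x => {f, x}

/-! ### Big-step semantics of the source language -/

/-- Values that a memory cell can hold: constants and locations. -/
inductive Atom (L : Lang) where
  | unit
  | const (c : L.base.Carrier)
  | loc (ℓ : ℕ)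

/-- Source values; a closure holds its environment. -/
inductive Val (L : Lang) where
  | atom (a : Atom L)
  | clos (x : Var) (M : Term L) (R : Var → Option (Val L))
  | rclos (f x : Var) (M : Term L) (R : Var → Option (Val L))

/-- Environments: partial maps from variables to values. -/
abbrev Env (L : Lang) := Var → Option (Val L)

/-- Heaps: partial maps from locations to constants and locations. -/
abbrev Heap (L : Lang) := ℕ → Option (Atom L)

namespace Env
variable {L : Lang}

/-- The empty environment. -/
def empty : Env L := fun _ => none

/-- `R{x ↦ v}`. -/
def set (R : Env L) (x : Var) (v : Val L) : Env L := Function.update R x (some v)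

/-- `R ∖ x`. -/
def erase (R : Env L) (x : Var) : Env L := Function.update R x none

/-- `R` with the binding of `x` removed unless `σ` is sharable. -/
def excTy (R : Env L) (x : Var) (σ : FTy) : Env L := if σ.sharable then R else R.erase x

/-- `R` with the binding of `x` removed unless the type of `x` is sharable. -/
def exc (R : Env L) (x : Var) : Env L := R.excTy x x.ty

/-- The two components of `splitEnv(R, S)`. -/
def split (R : Env L) (S : Finset Var) : Env L × Env L :=
  (fun x => if x ∈ S then R x else none,
   fun x => if x ∉ S ∨ x.ty.sharable then R x else none)

end Env

/-- The empty heap. -/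
def Heap.empty {L : Lang} : Heap L := fun _ => none

/-- `H{ℓ ↦ a}`. -/
def Heap.set {L : Lang} (H : Heap L) (ℓ : ℕ) (a : Atom L) : Heap L :=
  Function.update H ℓ (some a)

/-- Answers of the source evaluation: `(v, R, H)` or `FAIL`. -/
inductive Ans (L : Lang) where
  | ok (v : Val L) (R : Env L) (H : Heap L)
  | fail

/-- The evaluation relation `(M, R, H) ⇓ ans` of the source language. -/
inductive Eval {L : Lang} : Term L → Env L → Heap L → Ans L → Prop
  | fail {R H} : Eval .fail R H .fail
  | unit {R H} : Eval .unit R H (.ok (.atom .unit) R H)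
  | const {c R H} : Eval (.const c) R H (.ok (.atom (.const c)) R H)
  | var {x R H v} (hx : R x = some v) : Eval (.var x) R H (.ok v (R.exc x) H)
  | op {k R H} {o : L.Op k} {xs : Fin k → Var} {cs : Fin k → L.base.Carrier}
      (hxs : ∀ i, R (xs i) = some (.atom (.const (cs i)))) :
      Eval (.op o xs) R H (.ok (.atom (.const (L.sem o cs))) R H)
  | deref {x R H ρ ℓ a} (hty : x.ty = .n (.r (.ref ρ))) (hx : R x = some (.atom (.loc ℓ)))
      (hℓ : H ℓ = some a) :
      Eval (.deref x) R H (.ok (.atom a) (R.excTy x (.n (.r ρ))) H)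
  | mkref {x R H ℓ a} (hx : R x = some (.atom a)) (fresh : H ℓ = none) :
      Eval (.mkref x) R H (.ok (.atom (.loc ℓ)) (R.exc x) (H.set ℓ a))
  | assign {y x R H ℓ a} (hy : R y = some (.atom (.loc ℓ))) (hx : R x = some (.atom a)) :
      Eval (.assign y x) R H (.ok (.atom .unit) (R.exc x) (H.set ℓ a))
  | letE {x M₁ M₂ R H v₁ R₁ H₁ v₂ R₂ H₂} (h₁ : Eval M₁ R H (.ok v₁ R₁ H₁))
      (h₂ : Eval M₂ (R₁.set x v₁) H₁ (.ok v₂ R₂ H₂)) :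
      Eval (.letE x M₁ M₂) R H (.ok v₂ (R₂.erase x) H₂)
  | letF₁ {x M₁ M₂ R H} (h₁ : Eval M₁ R H .fail) : Eval (.letE x M₁ M₂) R H .fail
  | letF₂ {x M₁ M₂ R H v₁ R₁ H₁} (h₁ : Eval M₁ R H (.ok v₁ R₁ H₁))
      (h₂ : Eval M₂ (R₁.set x v₁) H₁ .fail) : Eval (.letE x M₁ M₂) R H .fail
  | iteT {x M₁ M₂ R H c ans} (hx : R x = some (.atom (.const c))) (hc : L.base.Truthy c)
      (h : Eval M₁ R H ans) : Eval (.ite x M₁ M₂) R H ans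
  | iteF {x M₁ M₂ R H c ans} (hx : R x = some (.atom (.const c))) (hc : ¬ L.base.Truthy c)
      (h : Eval M₂ R H ans) : Eval (.ite x M₁ M₂) R H ans
  | lam {x M R H} :
      Eval (.lam x M) R H
        (.ok (.clos x M (R.split (Term.lam x M).FV).1) (R.split (Term.lam x M).FV).2 H)
  | fix {f x M R H} :
      Eval (.fix f x M) R H
        (.ok (.rclos f x M (R.split (Term.fix f x M).FV).1) (R.split (Term.fix f x M).FV).2 H)
  | app₁ {f x R H y M Rf vx v R' H'} (hf : R f = some (.clos y M Rf)) (hx : R x = some vx)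
      (h : Eval M (Env.set Rf y vx) H (.ok v R' H')) : Eval (.app f x) R H (.ok v R H')
  | app₁F {f x R H y M Rf vx} (hf : R f = some (.clos y M Rf)) (hx : R x = some vx)
      (h : Eval M (Env.set Rf y vx) H .fail) : Eval (.app f x) R H .fail
  | app₂ {f x R H g y M Rf vx v R' H'} (hf : R f = some (.rclos g y M Rf)) (hx : R x = some vx)
      (h : Eval M (Env.set (Env.set Rf g (.rclos g y M Rf)) y vx) H (.ok v R' H')) :
      Eval (.app f x) R H (.ok v R H')
  | app₂F {f x R H g y M Rf vx} (hf : R f = some (.rclos g y M Rf)) (hx : R x = some vx)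
      (h : Eval M (Env.set (Env.set Rf g (.rclos g y M Rf)) y vx) H .fail) :
      Eval (.app f x) R H .fail

/-! ### The target language: pure PCF with tuples -/

/-- Target variables: those of the source, and reserved names for the auxiliary variables
that the translation introduces (which are thereby fresh). -/
inductive PVar where
  | src (x : Var)
  /-- a tuple being taken apart -/
  | p
  /-- a store -/
  | h
  /-- a result -/
  | r
  /-- the code of a closure about to be called -/
  | code
  deriving DecidableEq

/-- Target terms. Components of tuples are numbered from `0`. -/
inductive PTerm (L : Lang) where
  | fail
  | unit
  | const (c : L.base.Carrier)
  | var (x : PVar)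
  | op {k : ℕ} (o : L.Op k) (xs : Fin k → PVar)
  | tuple {k : ℕ} (Ns : Fin k → PTerm L)
  | proj (N : PTerm L) (j : ℕ)
  | letE (x : PVar) (N₁ N₂ : PTerm L)
  | ite (x : PVar) (N₁ N₂ : PTerm L)
  | lam (x : PVar) (N : PTerm L)
  | fix (f x : PVar) (N : PTerm L)
  | app (f : PVar) (N : PTerm L)

/-- Target values. -/
inductive PVal (L : Lang) where
  | unit
  | const (c : L.base.Carrier)
  | clos (x : PVar) (N : PTerm L) (S : PVar → Option (PVal L))
  | rclos (f x : PVar) (N : PTerm L) (S : PVar → Option (PVal L))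
  | tuple {k : ℕ} (ws : Fin k → PVal L)

/-- Target environments. -/
abbrev PEnv (L : Lang) := PVar → Option (PVal L)

/-- The empty target environment. -/
def PEnv.empty {L : Lang} : PEnv L := fun _ => none

/-- `S{x ↦ w}`. -/
def PEnv.set {L : Lang} (S : PEnv L) (x : PVar) (w : PVal L) : PEnv L :=
  Function.update S x (some w)

/-- Answers of the target evaluation: a value or `FAIL`. -/
inductive PAns (L : Lang) where
  | ok (w : PVal L)
  | fail

/-- The evaluation relation `(N, S) ⇓ ans` of the target language. -/
inductive PEval {L : Lang} : PTerm L → PEnv L → PAns L → Prop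
  | fail {S} : PEval .fail S .fail
  | unit {S} : PEval .unit S (.ok .unit)
  | const {c S} : PEval (.const c) S (.ok (.const c))
  | var {x S w} (hx : S x = some w) : PEval (.var x) S (.ok w)
  | op {k S} {o : L.Op k} {xs : Fin k → PVar} {cs : Fin k → L.base.Carrier}
      (hxs : ∀ i, S (xs i) = some (.const (cs i))) :
      PEval (.op o xs) S (.ok (.const (L.sem o cs)))
  | tuple {k S} {Ns : Fin k → PTerm L} {ws : Fin k → PVal L}
      (h : ∀ i, PEval (Ns i) S (.ok (ws i))) : PEval (.tuple Ns) S (.ok (.tuple ws))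
  | tupleF {k S} {Ns : Fin k → PTerm L} {ws : Fin k → PVal L} (i : Fin k)
      (h : ∀ j, j < i → PEval (Ns j) S (.ok (ws j))) (hi : PEval (Ns i) S .fail) :
      PEval (.tuple Ns) S .fail
  | proj {N S k} {ws : Fin k → PVal L} (j : Fin k) (h : PEval N S (.ok (.tuple ws))) :
      PEval (.proj N j) S (.ok (ws j))
  | projF {N S j} (h : PEval N S .fail) : PEval (.proj N j) S .fail
  | letE {x N₁ N₂ S w₁ ans} (h₁ : PEval N₁ S (.ok w₁)) (h₂ : PEval N₂ (S.set x w₁) ans) :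
      PEval (.letE x N₁ N₂) S ans
  | letF {x N₁ N₂ S} (h₁ : PEval N₁ S .fail) : PEval (.letE x N₁ N₂) S .fail
  | iteT {x N₁ N₂ S c ans} (hx : S x = some (.const c)) (hc : L.base.Truthy c)
      (h : PEval N₁ S ans) : PEval (.ite x N₁ N₂) S ans
  | iteF {x N₁ N₂ S c ans} (hx : S x = some (.const c)) (hc : ¬ L.base.Truthy c)
      (h : PEval N₂ S ans) : PEval (.ite x N₁ N₂) S ans
  | lam {x N S} : PEval (.lam x N) S (.ok (.clos x N S))
  | fix {f x N S} : PEval (.fix f x N) S (.ok (.rclos f x N S))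
  | app₁ {f N S y N₁ Sf v ans} (hN : PEval N S (.ok v)) (hf : S f = some (.clos y N₁ Sf))
      (h : PEval N₁ (PEnv.set Sf y v) ans) : PEval (.app f N) S ans
  | app₂ {f N S g y N₁ Sf v ans} (hN : PEval N S (.ok v)) (hf : S f = some (.rclos g y N₁ Sf))
      (h : PEval N₁ (PEnv.set (PEnv.set Sf g (.rclos g y N₁ Sf)) y v) ans) :
      PEval (.app f N) S ans
  | appF {f N S} (hN : PEval N S .fail) : PEval (.app f N) S .fail

/-! ### Derived forms of the target language -/

namespace PTerm
variable {L : Lang}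

/-- A source variable as a target term. -/
def v (x : Var) : PTerm L := .var (.src x)

/-- `(N₁, N₂)`. -/
def pair (N₁ N₂ : PTerm L) : PTerm L := .tuple ![N₁, N₂]

/-- `(N₁, N₂, N₃)`. -/
def triple (N₁ N₂ N₃ : PTerm L) : PTerm L := .tuple ![N₁, N₂, N₃]

/-- The flat tuple of the terms in a list. -/
def tupleOf (Ns : List (PTerm L)) : PTerm L := .tuple fun i : Fin Ns.length => Ns.get i

/-- A closure: the pair of its local store and its code. -/
def closure (code env : PTerm L) : PTerm L := pair env code

/-- The local store of the closure `f`. -/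
def envOf (f : Var) : PTerm L := .proj (v f) 0

/-- The code of the closure `f`. -/
def codeOf (f : Var) : PTerm L := .proj (v f) 1

/-- `let (x, y) = p in N`. -/
def split₂ (x y : PVar) (N : PTerm L) : PTerm L :=
  .letE x (.proj (.var .p) 0) (.letE y (.proj (.var .p) 1) N)

/-- `let (x, y) = N₁ in N₂`. -/
def letPair (x y : PVar) (N₁ N₂ : PTerm L) : PTerm L := .letE .p N₁ (split₂ x y N₂)

/-- `let (x, y, z) = N₁ in N₂`. -/
def letTriple (x y z : PVar) (N₁ N₂ : PTerm L) : PTerm L :=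
  .letE .p N₁ (.letE x (.proj (.var .p) 0)
    (.letE y (.proj (.var .p) 1) (.letE z (.proj (.var .p) 2) N₂)))

/-- `λ(x, y). N`. -/
def lamPair (x y : PVar) (N : PTerm L) : PTerm L := .lam .p (split₂ x y N)

/-- `fix f (x, y). N`. -/
def fixPair (f x y : PVar) (N : PTerm L) : PTerm L := .fix f .p (split₂ x y N)

/-- The components contributed to a store by one binding. -/
def packVar (x : Var) : List (PTerm L) :=
  match x.ty with
  | .n (.r (.ref _)) => [v x]
  | .n (.fn _ n _) => List.ofFn fun j : Fin n => .proj (envOf x) j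
  | _ => []

/-- `pack_Γ`: the flat tuple of the current contents of the store described by `Γ`. -/
def pack (Γ : TEnv) : PTerm L := tupleOf (Γ.flatMap packVar)

/-- Rebinding of the variables of `Γ` from the components of the store `h`, starting with the
component `i`. -/
def unpackFrom (N : PTerm L) : ℕ → TEnv → PTerm L
  | _, [] => N
  | i, x :: Γ =>
    match x.ty with
    | .n (.r (.ref _)) => .letE (.src x) (.proj (.var .h) i) (unpackFrom N (i + 1) Γ)
    | .n (.fn _ n _) =>
      if n = 0 then unpackFrom N i Γ
      else .letE (.src x)
        (closure (codeOf x) (.tuple fun j : Fin n => .proj (.var .h) (i + j)))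
        (unpackFrom N (i + n) Γ)
    | _ => unpackFrom N i Γ

/-- `unpack_Γ h in N`. -/
def unpack (Γ : TEnv) (N : PTerm L) : PTerm L := unpackFrom N 0 Γ

end PTerm

/-! ### The type-directed translation -/

open PTerm in
/-- The judgment `Γ ⊢ M : τ ⊣ Γ' ⇝ N`. Without the last argument, the rules are the typing rules
of the source language. -/
inductive Tr {L : Lang} : TEnv → Term L → NTy → TEnv → PTerm L → Prop
  | fail {Γ τ} (wf : Γ.WF) (hτ : τ.IsBase) : Tr Γ .fail τ Γ (pair .fail (pack Γ))
  | unit {Γ} (wf : Γ.WF) : Tr Γ .unit .unit Γ (pair .unit (pack Γ))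
  | const {Γ c} (wf : Γ.WF) : Tr Γ (.const c) .b Γ (pair (.const c) (pack Γ))
  | var {Γ x τ} (wf : Γ.WF) (hx : Γ.Has x (.n τ)) :
      Tr Γ (.var x) τ (Γ.exc x) (pair (v x) (pack (Γ.exc x)))
  | op {Γ k} {o : L.Op k} {xs : Fin k → Var} (wf : Γ.WF) (hxs : ∀ i, Γ.Has (xs i) (.n .b)) :
      Tr Γ (.op o xs) .b Γ (pair (.op o fun i => .src (xs i)) (pack Γ))
  | deref {Γ x ρ} (wf : Γ.WF) (hx : Γ.Has x (.n (.r (.ref ρ)))) :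
      Tr Γ (.deref x) (.r ρ) (Γ.excTy x (.n (.r ρ)))
        (pair (v x) (pack (Γ.excTy x (.n (.r ρ)))))
  | mkref {Γ x ρ} (wf : Γ.WF) (hx : Γ.Has x (.n (.r ρ))) :
      Tr Γ (.mkref x) (.r (.ref ρ)) (Γ.exc x) (pair (v x) (pack (Γ.exc x)))
  | assign {Γ y x ρ} (wf : Γ.WF) (hy : Γ.Has y (.n (.r (.ref ρ)))) (hx : Γ.Has x (.n (.r ρ))) :
      Tr Γ (.assign y x) .unit (Γ.exc x)
        (.letE (.src y) (v x) (pair .unit (pack (Γ.exc x))))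
  | letE {Γ Γ' Γ'' x τ τ' M₁ M₂ N₁ N₂} (hx : x.ty = .n τ') (h₁ : Tr Γ M₁ τ' Γ'' N₁)
      (h₂ : Tr (Γ'' ++ [x]) M₂ τ Γ' N₂) :
      Tr Γ (.letE x M₁ M₂) τ (Γ'.erase x) (letPair (.src x) .h N₁ (unpack Γ'' N₂))
  | ite {Γ Γ' x τ M₁ M₂ N₁ N₂} (hx : Γ.Has x (.n .b)) (h₁ : Tr Γ M₁ τ Γ' N₁)
      (h₂ : Tr Γ M₂ τ Γ' N₂) : Tr Γ (.ite x M₁ M₂) τ Γ' (.ite (.src x) N₁ N₂)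
  | lam {Γ Γ' x τ₁ τ₂ M N} {Δ : NTEnv} (wf : Γ.WF) (hx : x.ty = .n τ₁)
      (h : Tr (Δ.toTEnv ++ [x]) M τ₂ (Δ.toTEnv ++ [x]) N)
      (hs : (Δ.toTEnv, Γ') = Γ.split (Term.lam x M).FV) :
      Tr Γ (.lam x M) (.fn τ₁ Δ.size τ₂) Γ'
        (pair
          (closure
            (lamPair (.src x) .h (unpack Δ.toTEnv (letPair .r .h N
              (unpack (Δ.toTEnv ++ [x]) (triple (.var .r) (v x) (pack Δ.toTEnv))))))
            (pack Δ.toTEnv))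
          (pack Γ'))
  | fix {Γ Γ' f x τ₁ τ₂ M N} {Δ : NTEnv} (wf : Γ.WF) (hf : f.ty = .rfun τ₁ Δ τ₂)
      (hx : x.ty = .n τ₁)
      (h : Tr (Δ.toTEnv ++ [f, x]) M τ₂ (Δ.toTEnv ++ [f, x]) N)
      (hs : (Δ.toTEnv, Γ') = Γ.split (Term.fix f x M).FV) :
      Tr Γ (.fix f x M) (.fn τ₁ Δ.size τ₂) Γ'
        (pair
          (closure
            (fixPair (.src f) (.src x) .h (unpack Δ.toTEnv (letPair .r .h N
              (unpack (Δ.toTEnv ++ [f, x]) (triple (.var .r) (v x) (pack Δ.toTEnv))))))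
            (pack Δ.toTEnv))
          (pack Γ'))
  | app {Γ f x τ₁ m τ₂} (wf : Γ.WF) (hf : Γ.Has f (.n (.fn τ₁ m τ₂))) (hx : Γ.Has x (.n τ₁)) :
      Tr Γ (.app f x) τ₂ Γ
        (letTriple .r (.src x) .h
          (.letE .code (codeOf f) (.app .code (pair (v x) (envOf f))))
          (.letE (.src f) (closure (codeOf f) (.var .h)) (pair (.var .r) (pack Γ))))
  | rapp {Γ f x τ₁ τ₂} {Δ : NTEnv} (wf : Γ.WF) (hf : Γ.Has f (.rfun τ₁ Δ τ₂))
      (hx : Γ.Has x (.n τ₁)) (hΔ : Δ.toTEnv.Sublist ((Γ.erase f).erase x)) :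
      Tr Γ (.app f x) τ₂ Γ
        (.letE .h (pack Δ.toTEnv)
          (letTriple .r (.src x) .h (.app (.src f) (pair (v x) (.var .h)))
            (unpack Δ.toTEnv (pair (.var .r) (pack Γ)))))

end LinRef

/-! Linearity gives each heap cell at most one owner among the live variables, so the mutable state
behind a variable can travel with it as a pure value: a reference is represented by its current
contents, a closure by its code together with the current contents of the store that it has
captured.

The invariant is a relation with ownership. `VRel` attaches a set of locations to each related pair;
different variables of an environment own disjoint sets, and a value of size zero owns nothing
(`VRel.eq_empty`), so sharable variables can be duplicated. The relation reads only owned cells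
(`VRel.congr_heap`), hence a computation confined to the cells of some variables leaves all others
related (`StoreRel.frame`). Environments captured by target closures hold old values, but only the
store components of these go stale: `FTy.SameCode` is preserved, and unpacking joins the captured
code with the current store. A recursive function inside its own body owns nothing at all. Its store
consists of the current values of the captured variables, which are still in the environment, and
`FunsRel` ties the function to them.

An equivalence is needed although programs may diverge and the source chooses locations freely.
Therefore `Sim` matches every outcome of either side by one of the other, and the induction is on a
measure that both languages share, the nesting depth of calls. Each source call is translated to
exactly one target call, and packing and unpacking make none, so the same bound serves both sides.
Given a simulation of calls, `Tr.sim` simulates terms by induction on the translation; applied to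
function bodies it turns simulation at depth `k` into simulation at depth `k + 1` (`CallSim.succ`).
Since `FAIL` is related only to `FAIL`, the theorem follows. -/

namespace LinRef
variable {L : Lang}

/-! ### Evaluation relative to a relation for calls

Evaluation of terms is restated by recursion on the term, relative to a relation that describes
the outcome of calls; bounding the depth of calls then gives an induction that both languages
share. -/

/-- Sets the environment of a successful answer. -/
def Ans.mapEnv (g : Env L → Env L) : Ans L → Ans L
  | .ok v R H => .ok v (g R) H
  | .fail => .fail

/-- Source evaluation, with the outcome of calls given by `call`. -/
def Term.ev (call : Val L → Val L → Heap L → Ans L → Prop) :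
    Term L → Env L → Heap L → Ans L → Prop
  | .fail, _, _, a => a = .fail
  | .unit, R, H, a => a = .ok (.atom .unit) R H
  | .const c, R, H, a => a = .ok (.atom (.const c)) R H
  | .var x, R, H, a => ∃ v, R x = some v ∧ a = .ok v (R.exc x) H
  | .op (k := k) o xs, R, H, a =>
    ∃ cs : Fin k → L.base.Carrier, (∀ i, R (xs i) = some (.atom (.const (cs i)))) ∧
      a = .ok (.atom (.const (L.sem o cs))) R H
  | .deref x, R, H, a =>
    ∃ ρ ℓ b, x.ty = .n (.r (.ref ρ)) ∧ R x = some (.atom (.loc ℓ)) ∧ H ℓ = some b ∧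
      a = .ok (.atom b) (R.excTy x (.n (.r ρ))) H
  | .mkref x, R, H, a =>
    ∃ ℓ b, R x = some (.atom b) ∧ H ℓ = none ∧ a = .ok (.atom (.loc ℓ)) (R.exc x) (H.set ℓ b)
  | .assign y x, R, H, a =>
    ∃ ℓ b, R y = some (.atom (.loc ℓ)) ∧ R x = some (.atom b) ∧
      a = .ok (.atom .unit) (R.exc x) (H.set ℓ b)
  | .letE x M₁ M₂, R, H, a =>
    ∃ a₁, M₁.ev call R H a₁ ∧
      match a₁ with
      | .fail => a = .fail
      | .ok v R₁ H₁ => ∃ a₂, M₂.ev call (R₁.set x v) H₁ a₂ ∧ a = a₂.mapEnv (·.erase x)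
  | .ite x M₁ M₂, R, H, a =>
    ∃ c, R x = some (.atom (.const c)) ∧
      ((L.base.Truthy c ∧ M₁.ev call R H a) ∨ (¬ L.base.Truthy c ∧ M₂.ev call R H a))
  | .lam x M, R, H, a =>
    a = .ok (.clos x M (R.split (Term.lam x M).FV).1) (R.split (Term.lam x M).FV).2 H
  | .fix f x M, R, H, a =>
    a = .ok (.rclos f x M (R.split (Term.fix f x M).FV).1) (R.split (Term.fix f x M).FV).2 H
  | .app f x, R, H, a =>
    ∃ u v, R f = some u ∧ R x = some v ∧ ∃ a₁, call u v H a₁ ∧ a = a₁.mapEnv fun _ => R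

/-- Source calls of nesting depth at most `k`. -/
def Val.call : ℕ → Val L → Val L → Heap L → Ans L → Prop
  | k + 1, .clos y M R, v, H, a => M.ev (Val.call k) (Env.set R y v) H a
  | k + 1, .rclos g y M R, v, H, a =>
    M.ev (Val.call k) (Env.set (Env.set R g (.rclos g y M R)) y v) H a
  | _, _, _, _, _ => False

/-- Target evaluation, with the outcome of calls given by `call`. -/
def PTerm.ev (call : PVal L → PVal L → PAns L → Prop) : PTerm L → PEnv L → PAns L → Prop
  | .fail, _, a => a = .fail
  | .unit, _, a => a = .ok .unit
  | .const c, _, a => a = .ok (.const c)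
  | .var x, S, a => ∃ w, S x = some w ∧ a = .ok w
  | .op (k := k) o xs, S, a =>
    ∃ cs : Fin k → L.base.Carrier, (∀ i, S (xs i) = some (.const (cs i))) ∧
      a = .ok (.const (L.sem o cs))
  | .tuple Ns, S, a =>
    (∃ ws, (∀ i, (Ns i).ev call S (.ok (ws i))) ∧ a = .ok (.tuple ws)) ∨
      ∃ i, ∃ ws : _ → PVal L, (∀ j, j < i → (Ns j).ev call S (.ok (ws j))) ∧
        (Ns i).ev call S .fail ∧ a = .fail
  | .proj N j, S, a =>
    ∃ a₁, N.ev call S a₁ ∧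
      match a₁ with
      | .fail => a = .fail
      | .ok w => ∃ (k : ℕ) (ws : Fin k → PVal L) (hj : j < k), w = .tuple ws ∧ a = .ok (ws ⟨j, hj⟩)
  | .letE x N₁ N₂, S, a =>
    ∃ a₁, N₁.ev call S a₁ ∧
      match a₁ with
      | .fail => a = .fail
      | .ok w => N₂.ev call (S.set x w) a
  | .ite x N₁ N₂, S, a =>
    ∃ c, S x = some (.const c) ∧
      ((L.base.Truthy c ∧ N₁.ev call S a) ∨ (¬ L.base.Truthy c ∧ N₂.ev call S a))
  | .lam x N, S, a => a = .ok (.clos x N S)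
  | .fix f x N, S, a => a = .ok (.rclos f x N S)
  | .app f N, S, a =>
    ∃ a₁, N.ev call S a₁ ∧
      match a₁ with
      | .fail => a = .fail
      | .ok w => ∃ c, S f = some c ∧ call c w a

/-- Target calls of nesting depth at most `k`. -/
def PVal.call : ℕ → PVal L → PVal L → PAns L → Prop
  | k + 1, .clos y N S, w, a => N.ev (PVal.call k) (PEnv.set S y w) a
  | k + 1, .rclos g y N S, w, a =>
    N.ev (PVal.call k) (PEnv.set (PEnv.set S g (.rclos g y N S)) y w) a
  | _, _, _, _ => False

/-! ### Monotonicity in the call relation and in the depth bound -/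

theorem Term.ev_mono {call call' : Val L → Val L → Heap L → Ans L → Prop}
    (hc : ∀ u v H a, call u v H a → call' u v H a) (M : Term L) :
    ∀ {R H a}, M.ev call R H a → M.ev call' R H a := by
  induction M with
  | letE x M₁ M₂ ih₁ ih₂ =>
    rintro R H a ⟨a₁, h₁, h₂⟩
    refine ⟨a₁, ih₁ h₁, ?_⟩
    cases a₁ with
    | fail => exact h₂
    | ok v R₁ H₁ =>
      obtain ⟨a₂, h₂, rfl⟩ := h₂
      exact ⟨a₂, ih₂ h₂, rfl⟩
  | ite x M₁ M₂ ih₁ ih₂ =>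
    rintro R H a ⟨c, hx, h | h⟩
    · exact ⟨c, hx, .inl ⟨h.1, ih₁ h.2⟩⟩
    · exact ⟨c, hx, .inr ⟨h.1, ih₂ h.2⟩⟩
  | app f x =>
    rintro R H a ⟨u, v, hu, hv, a₁, h, e⟩
    exact ⟨u, v, hu, hv, a₁, hc _ _ _ _ h, e⟩
  | _ => exact fun h => h

theorem PTerm.ev_mono {call call' : PVal L → PVal L → PAns L → Prop}
    (hc : ∀ u v a, call u v a → call' u v a) (N : PTerm L) :
    ∀ {S a}, N.ev call S a → N.ev call' S a := by
  induction N with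
  | tuple Ns ih =>
    rintro S a (⟨ws, h, e⟩ | ⟨i, ws, h, hi, e⟩)
    · exact .inl ⟨ws, fun i => ih i (h i), e⟩
    · exact .inr ⟨i, ws, fun j hj => ih j (h j hj), ih i hi, e⟩
  | proj N j ih =>
    rintro S a ⟨a₁, h₁, h₂⟩
    exact ⟨a₁, ih h₁, h₂⟩
  | letE x N₁ N₂ ih₁ ih₂ =>
    rintro S a ⟨a₁, h₁, h₂⟩
    refine ⟨a₁, ih₁ h₁, ?_⟩
    cases a₁ with
    | fail => exact h₂
    | ok w => exact ih₂ h₂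
  | ite x N₁ N₂ ih₁ ih₂ =>
    rintro S a ⟨c, hx, h | h⟩
    · exact ⟨c, hx, .inl ⟨h.1, ih₁ h.2⟩⟩
    · exact ⟨c, hx, .inr ⟨h.1, ih₂ h.2⟩⟩
  | app f N ih =>
    rintro S a ⟨a₁, h₁, h₂⟩
    refine ⟨a₁, ih h₁, ?_⟩
    cases a₁ with
    | fail => exact h₂
    | ok w =>
      obtain ⟨c, hf, h⟩ := h₂
      exact ⟨c, hf, hc _ _ _ h⟩
  | _ => exact fun h => h

/-- The call relation occurs only positively in `Term.ev`, so a larger bound admits more calls. This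
lets the bounds found for several subderivations be replaced by their maximum. -/
theorem Val.call_mono {k k' : ℕ} (hk : k ≤ k') :
    ∀ (u v : Val L) (H : Heap L) (a : Ans L), u.call k v H a → u.call k' v H a := by
  induction k generalizing k' with
  | zero =>
    intro u v H a h
    cases u <;> exact h.elim
  | succ k ih =>
    obtain ⟨k', rfl⟩ : ∃ j, k' = j + 1 := ⟨k' - 1, by omega⟩
    intro u v H a h
    cases u with
    | atom => exact h.elim
    | clos y M R => exact M.ev_mono (ih (by omega)) h
    | rclos g y M R => exact M.ev_mono (ih (by omega)) h

theorem PVal.call_mono {k k' : ℕ} (hk : k ≤ k') :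
    ∀ (u v : PVal L) (a : PAns L), u.call k v a → u.call k' v a := by
  induction k generalizing k' with
  | zero =>
    intro u v a h
    cases u <;> exact h.elim
  | succ k ih =>
    obtain ⟨k', rfl⟩ : ∃ j, k' = j + 1 := ⟨k' - 1, by omega⟩
    intro u v a h
    cases u with
    | clos y N S => exact N.ev_mono (ih (by omega)) h
    | rclos g y N S => exact N.ev_mono (ih (by omega)) h
    | _ => exact h.elim

/-! ### Big-step evaluation as evaluation of bounded depth: the source -/

theorem Eval.exists_ev {M : Term L} {R : Env L} {H : Heap L} {a : Ans L} (h : Eval M R H a) :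
    ∃ k, M.ev (Val.call k) R H a := by
  induction h with
  | fail => exact ⟨0, rfl⟩
  | unit => exact ⟨0, rfl⟩
  | const => exact ⟨0, rfl⟩
  | var hx => exact ⟨0, _, hx, rfl⟩
  | op hxs => exact ⟨0, _, hxs, rfl⟩
  | deref hty hx hℓ => exact ⟨0, _, _, _, hty, hx, hℓ, rfl⟩
  | mkref hx fresh => exact ⟨0, _, _, hx, fresh, rfl⟩
  | assign hy hx => exact ⟨0, _, _, hy, hx, rfl⟩
  | @letE x M₁ M₂ _ _ _ _ _ _ _ _ _ _ ih₁ ih₂ =>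
    obtain ⟨k₁, h₁⟩ := ih₁
    obtain ⟨k₂, h₂⟩ := ih₂
    exact ⟨max k₁ k₂, _, M₁.ev_mono (Val.call_mono (le_max_left _ _)) h₁, _,
      M₂.ev_mono (Val.call_mono (le_max_right _ _)) h₂, rfl⟩
  | letF₁ _ ih₁ =>
    obtain ⟨k, h⟩ := ih₁
    exact ⟨k, _, h, rfl⟩
  | @letF₂ x M₁ M₂ _ _ _ _ _ _ _ ih₁ ih₂ =>
    obtain ⟨k₁, h₁⟩ := ih₁
    obtain ⟨k₂, h₂⟩ := ih₂
    exact ⟨max k₁ k₂, _, M₁.ev_mono (Val.call_mono (le_max_left _ _)) h₁, _,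
      M₂.ev_mono (Val.call_mono (le_max_right _ _)) h₂, rfl⟩
  | iteT hx hc _ ih =>
    obtain ⟨k, h⟩ := ih
    exact ⟨k, _, hx, .inl ⟨hc, h⟩⟩
  | iteF hx hc _ ih =>
    obtain ⟨k, h⟩ := ih
    exact ⟨k, _, hx, .inr ⟨hc, h⟩⟩
  | lam => exact ⟨0, rfl⟩
  | fix => exact ⟨0, rfl⟩
  | app₁ hf hx _ ih | app₁F hf hx _ ih | app₂ hf hx _ ih | app₂F hf hx _ ih =>
    obtain ⟨k, h⟩ := ih
    exact ⟨k + 1, _, _, hf, hx, _, h, rfl⟩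

/-- The application case is isolated as a hypothesis, so that this induction on the term is
independent of the induction on the depth in `Eval.of_call`, which supplies it. -/
theorem Eval.of_ev {call : Val L → Val L → Heap L → Ans L → Prop}
    (hc₁ : ∀ {f x} {R : Env L} {u v H a}, R f = some u → R x = some v → call u v H a →
      Eval (.app f x) R H (a.mapEnv fun _ => R))
    (M : Term L) : ∀ {R H a}, M.ev call R H a → Eval M R H a := by
  induction M with
  | fail => rintro R H a rfl; exact .fail
  | unit => rintro R H a rfl; exact .unit
  | const c => rintro R H a rfl; exact .const
  | var x => rintro R H a ⟨v, hx, rfl⟩; exact .var hx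
  | op o xs => rintro R H a ⟨cs, hxs, rfl⟩; exact .op hxs
  | deref x => rintro R H a ⟨ρ, ℓ, b, hty, hx, hℓ, rfl⟩; exact .deref hty hx hℓ
  | mkref x => rintro R H a ⟨ℓ, b, hx, hℓ, rfl⟩; exact .mkref hx hℓ
  | assign y x => rintro R H a ⟨ℓ, b, hy, hx, rfl⟩; exact .assign hy hx
  | letE x M₁ M₂ ih₁ ih₂ =>
    rintro R H a ⟨a₁, h₁, h₂⟩
    cases a₁ with
    | fail => obtain rfl := h₂; exact .letF₁ (ih₁ h₁)
    | ok v R₁ H₁ =>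
      obtain ⟨a₂, h₂, rfl⟩ := h₂
      cases a₂ with
      | fail => exact .letF₂ (ih₁ h₁) (ih₂ h₂)
      | ok => exact .letE (ih₁ h₁) (ih₂ h₂)
  | ite x M₁ M₂ ih₁ ih₂ =>
    rintro R H a ⟨c, hx, h | h⟩
    · exact .iteT hx h.1 (ih₁ h.2)
    · exact .iteF hx h.1 (ih₂ h.2)
  | lam x M => rintro R H a rfl; exact .lam
  | fix f x M => rintro R H a rfl; exact .fix
  | app f x => rintro R H a ⟨u, v, hu, hv, a₁, h, rfl⟩; exact hc₁ hu hv h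

theorem Eval.of_call (k : ℕ) {f x : Var} {R : Env L} {u v : Val L} {H : Heap L} {a : Ans L}
    (hu : R f = some u) (hv : R x = some v) (h : u.call k v H a) :
    Eval (.app f x) R H (a.mapEnv fun _ => R) := by
  induction k generalizing f x R u v H a with
  | zero => cases u <;> exact h.elim
  | succ k ih =>
    cases u with
    | atom => exact h.elim
    | clos y M Rf =>
      have := Eval.of_ev ih M h
      cases a with
      | fail => exact .app₁F hu hv this
      | ok => exact .app₁ hu hv this
    | rclos g y M Rf =>
      have := Eval.of_ev ih M h
      cases a with
      | fail => exact .app₂F hu hv this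
      | ok => exact .app₂ hu hv this

/-- An evaluation is one with calls of bounded nesting depth. -/
theorem eval_iff_exists_ev {M : Term L} {R : Env L} {H : Heap L} {a : Ans L} :
    Eval M R H a ↔ ∃ k, M.ev (Val.call k) R H a :=
  ⟨Eval.exists_ev, fun ⟨k, h⟩ => Eval.of_ev (Eval.of_call k) M h⟩

/-! ### Big-step evaluation as evaluation of bounded depth: the target -/

theorem PEval.exists_ev {N : PTerm L} {S : PEnv L} {a : PAns L} (h : PEval N S a) :
    ∃ k, N.ev (PVal.call k) S a := by
  induction h with
  | fail => exact ⟨0, rfl⟩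
  | unit => exact ⟨0, rfl⟩
  | const => exact ⟨0, rfl⟩
  | var hx => exact ⟨0, _, hx, rfl⟩
  | op hxs => exact ⟨0, _, hxs, rfl⟩
  | @tuple k S Ns ws _ ih =>
    choose ks hks using ih
    exact ⟨Finset.univ.sup ks, .inl ⟨ws, fun i => (Ns i).ev_mono
      (PVal.call_mono (Finset.le_sup (Finset.mem_univ i))) (hks i), rfl⟩⟩
  | @tupleF k S Ns ws i _ _ ih ihi =>
    -- Only components before the failing one have a bound; `ks` takes arbitrary values at the
    -- others, which can only enlarge the supremum.
    choose! ks hks using ih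
    obtain ⟨k₁, hk₁⟩ := ihi
    exact ⟨max (Finset.univ.sup ks) k₁, .inr ⟨i, ws, fun j hj => (Ns j).ev_mono
      (PVal.call_mono (le_max_of_le_left (Finset.le_sup (Finset.mem_univ j)))) (hks j hj),
      (Ns i).ev_mono (PVal.call_mono (le_max_right _ _)) hk₁, rfl⟩⟩
  | proj j _ ih =>
    obtain ⟨k, h⟩ := ih
    exact ⟨k, _, h, _, _, j.2, rfl, rfl⟩
  | projF _ ih =>
    obtain ⟨k, h⟩ := ih
    exact ⟨k, _, h, rfl⟩
  | @letE x N₁ N₂ _ _ _ _ _ ih₁ ih₂ =>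
    obtain ⟨k₁, h₁⟩ := ih₁
    obtain ⟨k₂, h₂⟩ := ih₂
    exact ⟨max k₁ k₂, _, N₁.ev_mono (PVal.call_mono (le_max_left _ _)) h₁,
      N₂.ev_mono (PVal.call_mono (le_max_right _ _)) h₂⟩
  | letF _ ih =>
    obtain ⟨k, h⟩ := ih
    exact ⟨k, _, h, rfl⟩
  | iteT hx hc _ ih =>
    obtain ⟨k, h⟩ := ih
    exact ⟨k, _, hx, .inl ⟨hc, h⟩⟩
  | iteF hx hc _ ih =>
    obtain ⟨k, h⟩ := ih
    exact ⟨k, _, hx, .inr ⟨hc, h⟩⟩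
  | lam => exact ⟨0, rfl⟩
  | fix => exact ⟨0, rfl⟩
  | @app₁ f N _ _ N₁ _ _ _ _ hf _ ih₁ ih₂ =>
    obtain ⟨k₁, h₁⟩ := ih₁
    obtain ⟨k₂, h₂⟩ := ih₂
    exact ⟨max k₁ k₂ + 1, _, N.ev_mono (PVal.call_mono (by omega)) h₁, _, hf,
      N₁.ev_mono (PVal.call_mono (le_max_right _ _)) h₂⟩
  | @app₂ f N _ _ _ N₁ _ _ _ _ hf _ ih₁ ih₂ =>
    obtain ⟨k₁, h₁⟩ := ih₁
    obtain ⟨k₂, h₂⟩ := ih₂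
    exact ⟨max k₁ k₂ + 1, _, N.ev_mono (PVal.call_mono (by omega)) h₁, _, hf,
      N₁.ev_mono (PVal.call_mono (le_max_right _ _)) h₂⟩
  | appF _ ih =>
    obtain ⟨k, h⟩ := ih
    exact ⟨k, _, h, rfl⟩

theorem PEval.of_ev {call : PVal L → PVal L → PAns L → Prop}
    (hc : ∀ {f N} {S : PEnv L} {c w a}, PEval N S (.ok w) → S f = some c → call c w a →
      PEval (.app f N) S a)
    (N : PTerm L) : ∀ {S a}, N.ev call S a → PEval N S a := by
  induction N with
  | fail => rintro S a rfl; exact .fail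
  | unit => rintro S a rfl; exact .unit
  | const c => rintro S a rfl; exact .const
  | var x => rintro S a ⟨v, hx, rfl⟩; exact .var hx
  | op o xs => rintro S a ⟨cs, hxs, rfl⟩; exact .op hxs
  | tuple Ns ih =>
    rintro S a (⟨ws, h, rfl⟩ | ⟨i, ws, h, hi, rfl⟩)
    · exact .tuple fun i => ih i (h i)
    · exact .tupleF i (fun j hj => ih j (h j hj)) (ih i hi)
  | proj N j ih =>
    rintro S a ⟨a₁, h₁, h₂⟩
    cases a₁ with
    | fail => obtain rfl := h₂; exact .projF (ih h₁)
    | ok w =>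
      obtain ⟨k, ws, hj, rfl, rfl⟩ := h₂
      exact .proj ⟨j, hj⟩ (ih h₁)
  | letE x N₁ N₂ ih₁ ih₂ =>
    rintro S a ⟨a₁, h₁, h₂⟩
    cases a₁ with
    | fail => obtain rfl := h₂; exact .letF (ih₁ h₁)
    | ok w => exact .letE (ih₁ h₁) (ih₂ h₂)
  | ite x N₁ N₂ ih₁ ih₂ =>
    rintro S a ⟨c, hx, h | h⟩
    · exact .iteT hx h.1 (ih₁ h.2)
    · exact .iteF hx h.1 (ih₂ h.2)
  | lam x N => rintro S a rfl; exact .lam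
  | fix f x N => rintro S a rfl; exact .fix
  | app f N ih =>
    rintro S a ⟨a₁, h₁, h₂⟩
    cases a₁ with
    | fail => obtain rfl := h₂; exact .appF (ih h₁)
    | ok w =>
      obtain ⟨c, hf, h⟩ := h₂
      exact hc (ih h₁) hf h

theorem PEval.of_call (k : ℕ) {f : PVar} {N : PTerm L} {S : PEnv L} {c w : PVal L} {a : PAns L}
    (hN : PEval N S (.ok w)) (hf : S f = some c) (h : c.call k w a) :
    PEval (.app f N) S a := by
  induction k generalizing f N S c w a with
  | zero => cases c <;> exact h.elim
  | succ k ih =>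
    cases c with
    | clos y N₁ Sf => exact .app₁ hN hf (PEval.of_ev ih N₁ h)
    | rclos g y N₁ Sf => exact .app₂ hN hf (PEval.of_ev ih N₁ h)
    | _ => exact h.elim

/-- An evaluation is one with calls of bounded nesting depth. -/
theorem pEval_iff_exists_ev {N : PTerm L} {S : PEnv L} {a : PAns L} :
    PEval N S a ↔ ∃ k, N.ev (PVal.call k) S a :=
  ⟨PEval.exists_ev, fun ⟨k, h⟩ => PEval.of_ev (PEval.of_call k) N h⟩

/-! ### Tuples, closures and their store components -/

/-- The tuple of a list of values. -/
def PVal.tup (us : List (PVal L)) : PVal L := .tuple us.get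

/-- The closure with local store `us` and code `c`. -/
def PVal.closure (us : List (PVal L)) (c : PVal L) : PVal L := .tuple ![.tup us, c]

/-- The components of a tuple. -/
def PVal.elems : PVal L → List (PVal L)
  | .tuple ws => List.ofFn ws
  | _ => []

/-- The components of the local store of a closure. -/
def PVal.store (w : PVal L) : List (PVal L) := (w.elems.headD .unit).elems

theorem PVal.store_closure (us : List (PVal L)) (c : PVal L) : (PVal.closure us c).store = us := by
  simp [PVal.store, PVal.closure, PVal.elems, PVal.tup]

/-- The two stores are not known to have equal length, so their families are compared as lists
through `PVal.store`, avoiding heterogeneous equality. -/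
theorem PVal.closure_inj {us us' : List (PVal L)} {c c' : PVal L}
    (h : PVal.closure us c = PVal.closure us' c') : us = us' ∧ c = c' := by
  have h₁ := congrArg PVal.store h
  have h₂ := congrArg PVal.elems h
  simp only [PVal.store_closure] at h₁
  simp only [PVal.closure, PVal.elems, List.ofFn_inj] at h₂
  exact ⟨h₁, by simpa using congrFun h₂ 1⟩

/-- Bridges tuples indexed by a size read off a type or a term and tuples built from a list of store
contents. -/
theorem PVal.tuple_eq_tup {n : ℕ} {g : Fin n → PVal L} {us : List (PVal L)} (hn : us.length = n)
    (h : ∀ j (hj : j < n), us[j]? = some (g ⟨j, hj⟩)) : PVal.tuple g = PVal.tup us := by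
  subst hn
  unfold PVal.tup
  congr 1
  funext j
  have := h j j.2
  simpa using this.symm

/-- The components contributed to a store by a value of type `σ`. -/
def FTy.comps : FTy → PVal L → List (PVal L)
  | .n (.r (.ref _)), w => [w]
  | .n (.fn _ _ _), w => w.store
  | _, _ => []

/-- Values of a function type are closures with a store of the right size. -/
def FTy.Shaped : FTy → PVal L → Prop
  | .n (.fn _ m _), w => ∃ us c, w = PVal.closure us c ∧ us.length = m
  | _, _ => True

/-- The two values of type `σ` agree but for their store components. -/
def FTy.SameCode : FTy → PVal L → PVal L → Prop
  | .n (.r (.ref _)), _, _ => True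
  | .n (.fn _ m _), w, w₀ =>
    ∃ us us₀ c, w = PVal.closure us c ∧ w₀ = PVal.closure us₀ c ∧ us.length = m ∧ us₀.length = m
  | _, w, w₀ => w = w₀

theorem FTy.Shaped.sameCode_refl {σ : FTy} {w : PVal L} (h : σ.Shaped w) : σ.SameCode w w := by
  rcases σ with (_ | (_ | _) | _) | _
  case n.fn =>
    obtain ⟨us, c, rfl, hn⟩ := h
    exact ⟨us, us, c, rfl, rfl, hn, hn⟩
  all_goals simp [FTy.SameCode]

/-- At a function type both hypotheses decompose the middle closure, and by `PVal.closure_inj` they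
find the same code. -/
theorem FTy.SameCode.trans {σ : FTy} {w₁ w₂ w₃ : PVal L} (h : σ.SameCode w₁ w₂)
    (h' : σ.SameCode w₂ w₃) : σ.SameCode w₁ w₃ := by
  rcases σ with (_ | (_ | _) | _) | _
  case n.fn =>
    obtain ⟨us, us₀, c, rfl, rfl, hn, -⟩ := h
    obtain ⟨us', us₀', c', e, rfl, -, hn'⟩ := h'
    obtain ⟨rfl, rfl⟩ := PVal.closure_inj e
    exact ⟨us, us₀', c, rfl, rfl, hn, hn'⟩
  all_goals simp_all [FTy.SameCode]

/-- The contents of the store described by `Γ`, when the variables have the values `w`. -/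
def TEnv.comps (Γ : TEnv) (w : Var → PVal L) : List (PVal L) := Γ.flatMap fun x => x.ty.comps (w x)

/-! ### Deterministic target evaluation -/

/-- The only outcome of `N` in `S` is the value `w`. -/
def PTerm.Returns (call : PVal L → PVal L → PAns L → Prop) (N : PTerm L) (S : PEnv L)
    (w : PVal L) : Prop :=
  ∀ a, N.ev call S a ↔ a = .ok w

namespace PTerm

variable {call : PVal L → PVal L → PAns L → Prop} {S : PEnv L}

theorem returns_var {x : PVar} {w : PVal L} (h : S x = some w) :
    (PTerm.var x).Returns call S w := fun a => by
  simp [PTerm.ev, h]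

theorem returns_tuple {k : ℕ} {Ns : Fin k → PTerm L} {ws : Fin k → PVal L}
    (h : ∀ i, (Ns i).Returns call S (ws i)) : (PTerm.tuple Ns).Returns call S (.tuple ws) := by
  intro a
  constructor
  · rintro (⟨ws', h', rfl⟩ | ⟨i, ws', -, hi, rfl⟩)
    · have : ws' = ws := funext fun i => by simpa using (h i _).1 (h' i)
      rw [this]
    · simpa using (h i _).1 hi
  · rintro rfl
    exact .inl ⟨ws, fun i => (h i _).2 rfl, rfl⟩

theorem returns_pair {N₁ N₂ : PTerm L} {w₁ w₂ : PVal L} (h₁ : N₁.Returns call S w₁)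
    (h₂ : N₂.Returns call S w₂) : (pair N₁ N₂).Returns call S (.tuple ![w₁, w₂]) :=
  returns_tuple fun i => by fin_cases i <;> assumption

theorem returns_triple {N₁ N₂ N₃ : PTerm L} {w₁ w₂ w₃ : PVal L} (h₁ : N₁.Returns call S w₁)
    (h₂ : N₂.Returns call S w₂) (h₃ : N₃.Returns call S w₃) :
    (triple N₁ N₂ N₃).Returns call S (.tuple ![w₁, w₂, w₃]) :=
  returns_tuple fun i => by fin_cases i <;> assumption

theorem ev_pair_fail {N : PTerm L} {a : PAns L} : (pair .fail N).ev call S a ↔ a = .fail := by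
  constructor
  · rintro (⟨ws, h, rfl⟩ | ⟨i, ws, -, -, rfl⟩)
    · have h₀ : PAns.ok (ws 0) = .fail := h 0
      cases h₀
    · rfl
  · rintro rfl
    -- The first component fails, so no earlier values are needed and the family is a dummy.
    exact .inr ⟨0, fun _ => .unit, fun j hj => absurd hj (Fin.not_lt_zero j), rfl, rfl⟩

theorem returns_proj {N : PTerm L} {k : ℕ} {ws : Fin k → PVal L} (h : N.Returns call S (.tuple ws))
    {j : ℕ} (hj : j < k) : (PTerm.proj N j).Returns call S (ws ⟨j, hj⟩) := by
  intro a
  constructor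
  · rintro ⟨a₁, h₁, h₂⟩
    obtain rfl := (h _).1 h₁
    obtain ⟨k', ws', hj', e, rfl⟩ := h₂
    cases e
    rfl
  · rintro rfl
    exact ⟨_, (h _).2 rfl, k, ws, hj, rfl, rfl⟩

theorem returns_proj_tup {N : PTerm L} {us : List (PVal L)} (h : N.Returns call S (.tup us))
    {j : ℕ} {w : PVal L} (hj : us[j]? = some w) : (PTerm.proj N j).Returns call S w := by
  obtain ⟨hj', rfl⟩ := List.getElem?_eq_some_iff.1 hj
  exact returns_proj h hj'

theorem ev_letE_of_returns {N₁ N₂ : PTerm L} {x : PVar} {w : PVal L} {a : PAns L}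
    (h : N₁.Returns call S w) :
    (PTerm.letE x N₁ N₂).ev call S a ↔ N₂.ev call (S.set x w) a := by
  constructor
  · rintro ⟨a₁, h₁, h₂⟩
    obtain rfl := (h _).1 h₁
    exact h₂
  · exact fun h₂ => ⟨_, (h _).2 rfl, h₂⟩

theorem returns_envOf {f : Var} {us : List (PVal L)} {c : PVal L}
    (h : S (.src f) = some (.closure us c)) : (envOf f).Returns call S (.tup us) :=
  returns_proj (returns_var h) (j := 0) (by omega)

theorem returns_codeOf {f : Var} {us : List (PVal L)} {c : PVal L}
    (h : S (.src f) = some (.closure us c)) : (codeOf f).Returns call S c :=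
  returns_proj (returns_var h) (j := 1) (by omega)

theorem returns_closure {N₁ N₂ : PTerm L} {us : List (PVal L)} {c : PVal L}
    (h₁ : N₁.Returns call S c) (h₂ : N₂.Returns call S (.tup us)) :
    (closure N₁ N₂).Returns call S (.closure us c) :=
  returns_pair h₂ h₁

theorem returns_tupleOf {Ns : List (PTerm L)} {us : List (PVal L)}
    (h : List.Forall₂ (fun N u => N.Returns call S u) Ns us) :
    (tupleOf Ns).Returns call S (.tup us) := by
  have hl := h.length_eq
  rw [← PVal.tuple_eq_tup (g := fun i : Fin Ns.length => us.get (i.cast hl)) hl.symm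
    (fun j hj => by simp)]
  exact returns_tuple fun i => h.get i.2 (hl ▸ i.2)

theorem returns_packVar {x : Var} {w : PVal L} (h : S (.src x) = some w) (hw : x.ty.Shaped w) :
    List.Forall₂ (fun N u => PTerm.Returns call N S u) (packVar x) (x.ty.comps w) := by
  unfold packVar
  obtain ⟨nm, σ⟩ := x
  rcases σ with (_ | (_ | _) | ⟨_, n, _⟩) | _
  case n.r.ref => exact .cons (returns_var h) .nil
  case n.fn =>
    obtain ⟨us, c, rfl, rfl⟩ := hw
    simp only [FTy.comps, PVal.store_closure]
    rw [List.forall₂_iff_get]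
    refine ⟨by simp, fun i h₁ h₂ => ?_⟩
    simp only [List.get_eq_getElem, List.getElem_ofFn]
    exact returns_proj_tup (returns_envOf h) (List.getElem?_eq_getElem h₂)
  all_goals exact .nil

/-- `pack_Γ` returns the contents of the store. -/
theorem returns_pack {Γ : TEnv} {w : Var → PVal L} (h : ∀ x ∈ Γ, S (.src x) = some (w x))
    (hw : ∀ x ∈ Γ, x.ty.Shaped (w x)) : (pack Γ).Returns call S (.tup (Γ.comps w)) := by
  refine returns_tupleOf ?_
  induction Γ with
  | nil => exact .nil
  | cons x Γ ih =>
    simp only [List.mem_cons, forall_eq_or_imp] at h hw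
    exact List.rel_append (returns_packVar h.1 hw.1) (ih h.2 hw.2)

end PTerm

/-- `S` with the variables of `Γ` rebound to the values `w`. -/
def PEnv.rebind (S : PEnv L) (Γ : TEnv) (w : Var → PVal L) : PEnv L
  | .src x => if x ∈ Γ then some (w x) else S (.src x)
  | y => S y

theorem PEnv.rebind_mem {S : PEnv L} {Γ : TEnv} {w : Var → PVal L} {x : Var} (hx : x ∈ Γ) :
    S.rebind Γ w (.src x) = some (w x) := by
  simp [PEnv.rebind, hx]

theorem PEnv.rebind_notMem {S : PEnv L} {Γ : TEnv} {w : Var → PVal L} {x : Var} (hx : x ∉ Γ) :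
    S.rebind Γ w (.src x) = S (.src x) := by
  simp [PEnv.rebind, hx]

/-- The order of rebinding is immaterial, because the new value of a variable depends only on the
variable. -/
theorem PEnv.rebind_cons (S : PEnv L) (x : Var) (Γ : TEnv) (w : Var → PVal L) :
    S.rebind (x :: Γ) w = (S.set (.src x) (w x)).rebind Γ w := by
  funext y
  cases y with
  | src z =>
    by_cases hz : z ∈ Γ
    · simp [PEnv.rebind, hz]
    · by_cases hx : z = x
      · subst hx; simp [PEnv.rebind, hz, PEnv.set]
      · simp [PEnv.rebind, hz, hx, PEnv.set, Function.update]
  | _ => simp [PEnv.rebind, PEnv.set, Function.update]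

theorem PEnv.set_eq_self {S : PEnv L} {x : PVar} {w : PVal L} (h : S x = some w) :
    S.set x w = S := by
  unfold PEnv.set
  rw [← h, Function.update_eq_self]

theorem PEnv.set_same (S : PEnv L) (x : PVar) (w : PVal L) : S.set x w x = some w := by
  simp [PEnv.set]

theorem PEnv.set_ne (S : PEnv L) {x y : PVar} (h : y ≠ x) (w : PVal L) : S.set x w y = S y := by
  simp [PEnv.set, h]

/-! ### Unpacking a store -/

namespace PTerm

variable {call : PVal L → PVal L → PAns L → Prop}

/-- Invariant of the traversal: from component `i` on, the store holds the contents of the bindings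
still to be treated, followed by `extra`. A rebound closure takes its code from the old value in
`S`, which is why agreement up to store components is enough. Bindings without components are left
alone, and for them `FTy.SameCode` already forces equality. -/
theorem ev_unpackFrom {N : PTerm L} {a : PAns L} {w : Var → PVal L} {us extra : List (PVal L)}
    {Γ : TEnv} (hΓ : Γ.Nodup) {i : ℕ} {S : PEnv L} (hh : S .h = some (.tup us))
    (hus : us.drop i = Γ.comps w ++ extra)
    (hw : ∀ x ∈ Γ, ∃ w₀, S (.src x) = some w₀ ∧ x.ty.SameCode (w x) w₀) :
    (unpackFrom N i Γ).ev call S a ↔ N.ev call (S.rebind Γ w) a := by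
  induction Γ generalizing i S with
  | nil =>
    have : S.rebind [] w = S := by funext y; cases y <;> simp [PEnv.rebind]
    rw [this, unpackFrom]
  | cons x Γ ih =>
    rw [List.nodup_cons] at hΓ
    obtain ⟨⟨w₀, hx, hc⟩, hw'⟩ := List.forall_mem_cons.1 hw
    -- Rebinding `x` does not disturb the old values of the remaining variables, since they are
    -- different from `x`.
    have hstep (j : ℕ) (hus' : us.drop j = TEnv.comps Γ w ++ extra) :
        (unpackFrom N j Γ).ev call (S.set (.src x) (w x)) a ↔
          N.ev call (S.rebind (x :: Γ) w) a := by
      rw [PEnv.rebind_cons]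
      refine ih hΓ.2 (by rw [PEnv.set_ne _ (by simp)]; exact hh) hus' fun y hy => ?_
      rw [PEnv.set_ne _ (by rintro ⟨⟩; exact hΓ.1 hy)]
      exact hw' y hy
    have hcons : us.drop i = x.ty.comps (w x) ++ (TEnv.comps Γ w ++ extra) := by
      rw [hus]; simp [TEnv.comps]
    -- When nothing is consumed and the old value is already `w x`, omitting the rebinding is the
    -- same as rebinding to the old value.
    have hsame (hcomps : x.ty.comps (w x) = []) (e : w x = w₀) :
        (unpackFrom N i Γ).ev call S a ↔ N.ev call (S.rebind (x :: Γ) w) a := by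
      rw [← hstep i (by rw [hcons, hcomps, List.nil_append]), PEnv.set_eq_self (by rw [e, hx])]
    have hget (j : ℕ) : us[i + j]? = (us.drop i)[j]? := by rw [List.getElem?_drop]
    have hdrop (j : ℕ) : us.drop (i + j) = (us.drop i).drop j := by rw [List.drop_drop]
    rcases hσ : x.ty with (_ | (_ | _) | ⟨_, _ | m, _⟩) | _ <;> rw [hσ] at hc hcons hsame
    case n.r.ref =>
      simp only [unpackFrom, hσ]
      simp only [FTy.comps] at hcons
      rw [ev_letE_of_returns (w := w x)
        (returns_proj_tup (returns_var hh) (by simpa [hcons] using hget 0))]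
      exact hstep (i + 1) (by rw [hdrop, hcons]; simp)
    case n.fn.succ =>
      obtain ⟨vs, vs₀, c, e, rfl, hn, -⟩ := hc
      simp only [unpackFrom, hσ]
      simp only [FTy.comps, e, PVal.store_closure] at hcons
      rw [if_neg (Nat.succ_ne_zero m), ev_letE_of_returns (w := w x)]
      · exact hstep _ (by rw [hdrop, hcons, ← hn, List.drop_left])
      · rw [e]
        refine returns_closure (returns_codeOf hx) ?_
        rw [← PVal.tuple_eq_tup (g := fun j : Fin (m + 1) => vs.get (j.cast hn.symm)) hn
          (fun j hj => by simp [hn, hj])]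
        refine returns_tuple fun j => returns_proj_tup (returns_var hh) ?_
        rw [hget, hcons, List.getElem?_append_left (by omega)]
        simp
    case n.fn.zero =>
      simp only [unpackFrom, hσ, if_true]
      -- Both stores have length zero, so the closures with equal code are equal and need no
      -- rebinding.
      obtain ⟨vs, vs₀, c, e, rfl, hn, hn₀⟩ := hc
      rw [List.length_eq_zero_iff] at hn hn₀
      subst hn hn₀
      exact hsame (by rw [e]; exact PVal.store_closure _ _) e
    all_goals
      simp only [unpackFrom, hσ]
      exact hsame rfl hc

/-- `unpack_Γ h in N` is `N` with the variables of `Γ` rebound, if `h` starts with the contents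
of the store. -/
theorem ev_unpack {N : PTerm L} {a : PAns L} {w : Var → PVal L} {extra : List (PVal L)}
    {Γ : TEnv} (hΓ : Γ.Nodup) {S : PEnv L} (hh : S .h = some (.tup (Γ.comps w ++ extra)))
    (hw : ∀ x ∈ Γ, ∃ w₀, S (.src x) = some w₀ ∧ x.ty.SameCode (w x) w₀) :
    (unpack Γ N).ev call S a ↔ N.ev call (S.rebind Γ w) a :=
  ev_unpackFrom hΓ hh rfl hw

/-- The pair is read again after `x` has been bound, so `x` must not shadow it. -/
theorem ev_split₂ {x y : PVar} {N : PTerm L} {S : PEnv L} {a : PAns L} {w₁ w₂ : PVal L}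
    (hp : S .p = some (.tuple ![w₁, w₂])) (hx : .p ≠ x) :
    (split₂ x y N).ev call S a ↔ N.ev call ((S.set x w₁).set y w₂) a := by
  unfold split₂
  rw [ev_letE_of_returns (returns_proj (returns_var hp) (j := 0) (by omega)),
    ev_letE_of_returns
      (returns_proj (returns_var ((PEnv.set_ne _ hx _).trans hp)) (j := 1) (by omega))]
  rfl

end PTerm

open PTerm

/-! ### Properties of the typing rules -/

theorem NTEnv.exists_ty_of_mem {Δ : NTEnv} {x : Var} (hx : x ∈ Δ.toTEnv) : ∃ τ, x.ty = .n τ := by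
  obtain ⟨p, -, rfl⟩ := List.mem_map.1 hx
  exact ⟨p.2, rfl⟩

theorem Tr.wf {Γ Γ' : TEnv} {M : Term L} {τ : NTy} {N : PTerm L} (h : Tr Γ M τ Γ' N) : Γ.WF := by
  induction h <;> assumption

theorem TEnv.erase_sublist (Γ : TEnv) (x : Var) : (TEnv.erase Γ x).Sublist Γ := List.filter_sublist

theorem TEnv.mem_erase {Γ : TEnv} {x y : Var} : y ∈ TEnv.erase Γ x ↔ y ∈ Γ ∧ y ≠ x := by
  simp [TEnv.erase]

theorem TEnv.excTy_sublist (Γ : TEnv) (x : Var) (σ : FTy) : (Γ.excTy x σ).Sublist Γ := by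
  unfold TEnv.excTy
  split
  exacts [.refl Γ, Γ.erase_sublist x]

theorem TEnv.mem_excTy {Γ : TEnv} {x y : Var} {σ : FTy} :
    y ∈ Γ.excTy x σ ↔ y ∈ Γ ∧ (σ.sharable ∨ y ≠ x) := by
  unfold TEnv.excTy
  split <;> simp_all [TEnv.mem_erase]

theorem TEnv.mem_exc {Γ : TEnv} {x y : Var} :
    y ∈ Γ.exc x ↔ y ∈ Γ ∧ (x.ty.sharable ∨ y ≠ x) :=
  TEnv.mem_excTy

/-- Removing the last binding of an environment. -/
theorem TEnv.eq_erase_append {Γ Γ' : TEnv} {x : Var} (hx : x ∉ Γ) (h : Γ'.Sublist (Γ ++ [x])) :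
    (Γ'.erase x).Sublist Γ ∧ ∃ Γ₁, Γ' = Γ'.erase x ++ Γ₁ := by
  obtain ⟨A, B, rfl, hA, hB⟩ := List.sublist_append_iff.1 h
  have hA' : TEnv.erase A x = A :=
    List.filter_eq_self.2 fun y hy => by
      simpa using fun e : y = x => hx (e ▸ hA.subset hy)
  have hB' : TEnv.erase B x = [] :=
    List.filter_eq_nil_iff.2 fun y hy => by simpa using hB.subset hy
  have : TEnv.erase (A ++ B) x = A := by
    rw [← hA', TEnv.erase, List.filter_append]
    change TEnv.erase (TEnv.erase A x) x ++ TEnv.erase B x = _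
    rw [hA', hA', hB', List.append_nil]
  rw [this]
  exact ⟨hA, B, rfl⟩

theorem TEnv.notMem_of_nodup_append {Γ : TEnv} {x : Var} (h : (Γ ++ [x]).Nodup) : x ∉ Γ := by
  rw [List.nodup_append] at h
  exact fun hx => h.2.2 x hx x (by simp) rfl

/-- Evaluation only consumes bindings; the one that `let` adds comes last and is removed again at
the end. -/
theorem Tr.sublist {Γ Γ' : TEnv} {M : Term L} {τ : NTy} {N : PTerm L} (h : Tr Γ M τ Γ' N) :
    Γ'.Sublist Γ := by
  induction h with
  | fail | unit | const | op | app | rapp => exact .refl _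
  | var | deref | mkref | assign => exact TEnv.excTy_sublist _ _ _
  | letE hx h₁ h₂ ih₁ ih₂ =>
    exact (TEnv.eq_erase_append (TEnv.notMem_of_nodup_append h₂.wf.1) ih₂).1.trans ih₁
  | ite _ _ _ ih₁ _ => exact ih₁
  | lam _ _ _ hs | fix _ _ _ _ hs =>
    obtain ⟨-, rfl⟩ := Prod.mk.inj hs
    exact List.filter_sublist

/-! ### The relation between source and target values -/

/-- The body of the code of a translated function. -/
def funBody (Δ Θ : TEnv) (x : Var) (N : PTerm L) : PTerm L :=
  split₂ (.src x) .h (unpack Δ (letPair .r .h N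
    (unpack Θ (triple (.var .r) (v x) (pack Δ)))))

/-- `CodeRel τ₁ Δ τ₂ u R c S`: the function values `u`, with environment `R`, and `c`, with
environment `S`, have a body typed and translated in `Δ`. -/
inductive CodeRel (τ₁ : NTy) (Δ : NTEnv) (τ₂ : NTy) :
    Val L → Env L → PVal L → PEnv L → Prop
  | lam {x M N R S} (hx : x.ty = .n τ₁) (h : Tr (Δ.toTEnv ++ [x]) M τ₂ (Δ.toTEnv ++ [x]) N) :
      CodeRel τ₁ Δ τ₂ (.clos x M R) R (.clos .p (funBody Δ.toTEnv (Δ.toTEnv ++ [x]) x N) S) S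
  | fix {f x M N R S} (hf : f.ty = .rfun τ₁ Δ τ₂) (hx : x.ty = .n τ₁)
      (h : Tr (Δ.toTEnv ++ [f, x]) M τ₂ (Δ.toTEnv ++ [f, x]) N) :
      CodeRel τ₁ Δ τ₂ (.rclos f x M R) R
        (.rclos (.src f) .p (funBody Δ.toTEnv (Δ.toTEnv ++ [f, x]) x N) S) S

/-- The variables of `Δ` have the values `v` in `R` and, up to store components, `w` in `S`. -/
def Captures (Δ : NTEnv) (R : Env L) (S : PEnv L) (v : Var → Val L) (w : Var → PVal L) : Prop :=
  ∀ x ∈ Δ.toTEnv, R x = some (v x) ∧ ∃ w₀, S (.src x) = some w₀ ∧ x.ty.SameCode (w x) w₀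

/-- The sets `F x`, for `x` in `Γ`, are pairwise disjoint. -/
def Separate (Γ : TEnv) (F : Var → Set ℕ) : Prop :=
  ∀ x ∈ Γ, ∀ y ∈ Γ, x ≠ y → Disjoint (F x) (F y)

/-- All locations owned by the variables of `Γ`. -/
def footprint (Γ : TEnv) (F : Var → Set ℕ) : Set ℕ := {ℓ | ∃ x ∈ Γ, ℓ ∈ F x}

/-- `VRel H τ v w F`: in the heap `H`, the source value `v` of type `τ` is represented by the
target value `w`, and owns the locations in `F`. -/
inductive VRel (H : Heap L) : NTy → Val L → PVal L → Set ℕ → Prop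
  | unit : VRel H .unit (.atom .unit) .unit ∅
  | const (c : L.base.Carrier) : VRel H .b (.atom (.const c)) (.const c) ∅
  | ref {ρ ℓ a w F} (hℓ : H ℓ = some a) (h : VRel H (.r ρ) (.atom a) w F) (hF : ℓ ∉ F) :
      VRel H (.r (.ref ρ)) (.atom (.loc ℓ)) w (insert ℓ F)
  | fn {τ₁ τ₂ Δ u R c S v w F} (hc : CodeRel τ₁ Δ τ₂ u R c S) (hR : Captures Δ R S v w)
      (hv : ∀ x ∈ Δ.toTEnv, ∀ τ, x.ty = .n τ → VRel H τ (v x) (w x) (F x))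
      (hF : Separate Δ.toTEnv F) :
      VRel H (.fn τ₁ Δ.size τ₂) u (.closure (Δ.toTEnv.comps w) c) (footprint Δ.toTEnv F)

/-! ### Ownership: allocation, locality and size -/

theorem VRel.ne_none {H : Heap L} {τ : NTy} {v : Val L} {w : PVal L} {F : Set ℕ}
    (h : VRel H τ v w F) : ∀ ℓ ∈ F, H ℓ ≠ none := by
  induction h with
  | unit | const => simp
  | ref hℓ _ _ ih =>
    rintro ℓ (rfl | hm)
    · simp [hℓ]
    · exact ih ℓ hm
  | fn _ _ _ _ ih =>
    rintro ℓ ⟨x, hx, hm⟩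
    obtain ⟨τ, hτ⟩ := NTEnv.exists_ty_of_mem hx
    exact ih x hx τ hτ ℓ hm

/-- The locality behind all framing: the relation inspects the heap only at owned locations. -/
theorem VRel.congr_heap {H H' : Heap L} {τ : NTy} {v : Val L} {w : PVal L} {F : Set ℕ}
    (h : VRel H τ v w F) (hH : ∀ ℓ ∈ F, H' ℓ = H ℓ) : VRel H' τ v w F := by
  induction h with
  | unit => exact .unit
  | const c => exact .const c
  | ref hℓ _ hF ih =>
    exact .ref ((hH _ (by simp)).trans hℓ) (ih fun ℓ hm => hH ℓ (by simp [hm])) hF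
  | fn hc hR _ hF ih =>
    exact .fn hc hR (fun x hx τ hτ => ih x hx τ hτ fun ℓ hm => hH ℓ ⟨x, hx, hm⟩) hF

/-- A chain of references ends in a single base value, and that value alone represents the chain in
the target. -/
theorem RTy.cellSize_eq_one (ρ : RTy) : ρ.cellSize = 1 := by
  induction ρ with
  | base => rfl
  | ref ρ ih => exact ih

theorem TEnv.length_comps {Δ : NTEnv} {w : Var → PVal L}
    (h : ∀ x ∈ Δ.toTEnv, ∀ τ, x.ty = .n τ → (x.ty.comps (w x)).length = τ.size) :
    (Δ.toTEnv.comps w).length = Δ.size := by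
  simp only [TEnv.comps, List.length_flatMap, NTEnv.toTEnv, List.map_map, NTEnv.size]
  congr 1
  refine List.map_congr_left fun p hp => ?_
  exact h _ (List.mem_map_of_mem hp) p.2 rfl

theorem VRel.length_comps {H : Heap L} {τ : NTy} {v : Val L} {w : PVal L} {F : Set ℕ}
    (h : VRel H τ v w F) : ((FTy.n τ).comps w).length = τ.size := by
  induction h with
  | unit | const => rfl
  | ref => simp [FTy.comps, NTy.size, RTy.cellSize_eq_one]
  | fn _ _ _ _ ih =>
    simp only [FTy.comps, PVal.store_closure, NTy.size]
    exact TEnv.length_comps fun x hx τ hτ => by rw [hτ]; exact ih x hx τ hτ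

theorem VRel.shaped {H : Heap L} {τ : NTy} {v : Val L} {w : PVal L} {F : Set ℕ}
    (h : VRel H τ v w F) : (FTy.n τ).Shaped w := by
  have hl := h.length_comps
  cases h with
  | unit | const | ref => trivial
  | fn =>
    simp only [FTy.comps, PVal.store_closure] at hl
    exact ⟨_, _, rfl, hl⟩

/-- The soundness of sharing. A reference has size one, and a closure of size zero has captured only
values of size zero, which inductively own nothing. -/
theorem VRel.eq_empty {H : Heap L} {τ : NTy} {v : Val L} {w : PVal L} {F : Set ℕ}
    (h : VRel H τ v w F) (hτ : τ.size = 0) : F = ∅ := by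
  induction h with
  | unit | const => rfl
  | ref => simp [NTy.size, RTy.cellSize_eq_one] at hτ
  | @fn _ _ Δ _ _ _ _ _ _ _ _ _ _ _ ih =>
    refine Set.eq_empty_iff_forall_notMem.2 ?_
    rintro ℓ ⟨x, hx, hm⟩
    obtain ⟨p, hp, rfl⟩ := List.mem_map.1 hx
    have h0 : p.2.size = 0 := List.sum_eq_zero_iff.1 hτ _ (List.mem_map_of_mem hp)
    rw [ih _ hx p.2 rfl h0] at hm
    exact hm

theorem NTy.size_eq_zero_of_sharable {τ : NTy} (h : (FTy.n τ).sharable) : τ.size = 0 := by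
  rcases τ with _ | (_ | _) | ⟨_, _ | m, _⟩ <;> simp_all [FTy.sharable, NTy.size]

/-! ### Related environments -/

/-- The variables of `Γ` of normal type have related values and own separate parts of the heap. -/
structure StoreRel (H : Heap L) (Γ : TEnv) (v : Var → Val L) (w : Var → PVal L)
    (F : Var → Set ℕ) : Prop where
  val : ∀ x ∈ Γ, ∀ τ, x.ty = .n τ → VRel H τ (v x) (w x) (F x)
  rfun : ∀ x ∈ Γ, ∀ τ₁ Δ τ₂, x.ty = .rfun τ₁ Δ τ₂ → F x = ∅
  sep : Separate Γ F

/-- The variables of `Γ` of recursive function type have related values, which capture the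
current values of variables. -/
def FunsRel (Γ : TEnv) (v : Var → Val L) (w : Var → PVal L) : Prop :=
  ∀ f ∈ Γ, ∀ τ₁ Δ τ₂, f.ty = .rfun τ₁ Δ τ₂ →
    ∃ R S, CodeRel τ₁ Δ τ₂ (v f) R (w f) S ∧ Captures Δ R S v w

/-- From `H` to `H'` only the locations in `A` have changed, and `B` consists of locations in `A`
or new ones. -/
structure Frame (H H' : Heap L) (A B : Set ℕ) : Prop where
  eq : ∀ ℓ ∉ A, H ℓ ≠ none → H' ℓ = H ℓ
  sub : ∀ ℓ ∈ B, ℓ ∈ A ∨ H ℓ = none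

/-- Only finitely many locations are in use. -/
def Heap.IsFinite (H : Heap L) : Prop := {ℓ | H ℓ ≠ none}.Finite

/-- The translation of `mkref` always returns, so the source must always be able to allocate. -/
theorem Heap.IsFinite.exists_fresh {H : Heap L} (h : H.IsFinite) : ∃ ℓ, H ℓ = none := by
  obtain ⟨ℓ, hℓ⟩ := h.exists_notMem
  exact ⟨ℓ, by simpa using hℓ⟩

theorem Heap.IsFinite.set {H : Heap L} (h : H.IsFinite) (ℓ : ℕ) (a : Atom L) :
    (H.set ℓ a).IsFinite := by
  refine (h.insert ℓ).subset fun m hm => ?_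
  by_cases e : m = ℓ
  · exact .inl e
  · exact .inr (by simpa [Heap.set, e] using hm)

theorem Frame.refl (H : Heap L) {A B : Set ℕ} (h : B ⊆ A) : Frame H H A B :=
  ⟨fun _ _ _ => rfl, fun _ hℓ => .inl (h hℓ)⟩

/-- An old location outside `A` is not in `B`, as `B` contains only locations of `A` and new ones;
so the second computation leaves it alone too. -/
theorem Frame.trans {H H₁ H₂ : Heap L} {A B B' C : Set ℕ} (h : Frame H H₁ A B)
    (h' : Frame H₁ H₂ B' C) (hB : B' ⊆ B) : Frame H H₂ A C := by
  refine ⟨fun ℓ hA hH => ?_, fun ℓ hC => ?_⟩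
  · have e := h.eq ℓ hA hH
    rw [← e]
    refine h'.eq ℓ (fun hℓ => ?_) (e ▸ hH)
    rcases h.sub ℓ (hB hℓ) with h₁ | h₁
    exacts [hA h₁, hH h₁]
  · by_contra! hc
    rcases h'.sub ℓ hC with h₁ | h₁
    · rcases h.sub ℓ (hB h₁) with h₂ | h₂
      exacts [hc.1 h₂, hc.2 h₂]
    · exact hc.2 ((h.eq ℓ hc.1 hc.2).symm.trans h₁)

theorem Frame.mono {H H' : Heap L} {A A' B B' : Set ℕ} (h : Frame H H' A B) (hA : A ⊆ A')
    (hB : B' ⊆ B) : Frame H H' A' B' :=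
  ⟨fun ℓ hℓ => h.eq ℓ fun hm => hℓ (hA hm), fun ℓ hℓ => (h.sub ℓ (hB hℓ)).imp_left (@hA ℓ)⟩

/-! ### Rules for related stores -/

namespace StoreRel

variable {H : Heap L} {Γ Γ' : TEnv} {v : Var → Val L} {w : Var → PVal L} {F : Var → Set ℕ}

theorem shaped (h : StoreRel H Γ v w F) : ∀ x ∈ Γ, x.ty.Shaped (w x) := by
  intro x hx
  cases hσ : x.ty with
  | n τ => exact (h.val x hx τ hσ).shaped
  | rfun => trivial

theorem subset (h : StoreRel H Γ v w F) (hΓ : ∀ x ∈ Γ', x ∈ Γ) : StoreRel H Γ' v w F :=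
  ⟨fun x hx => h.val x (hΓ x hx), fun x hx => h.rfun x (hΓ x hx),
    fun x hx y hy => h.sep x (hΓ x hx) y (hΓ y hy)⟩

theorem ne_none (h : StoreRel H Γ v w F) {x : Var} (hx : x ∈ Γ) : ∀ ℓ ∈ F x, H ℓ ≠ none := by
  cases hσ : x.ty with
  | n τ => exact (h.val x hx τ hσ).ne_none
  | rfun => rw [h.rfun x hx _ _ _ hσ]; simp

theorem eq_empty (h : StoreRel H Γ v w F) {x : Var} (hx : x ∈ Γ) (hs : x.ty.sharable) :
    F x = ∅ := by
  cases hσ : x.ty with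
  | n τ => exact (h.val x hx τ hσ).eq_empty (NTy.size_eq_zero_of_sharable (hσ ▸ hs))
  | rfun => exact h.rfun x hx _ _ _ hσ

theorem congr (h : StoreRel H Γ v w F) {v' : Var → Val L} {w' : Var → PVal L}
    {F' : Var → Set ℕ} (hv : ∀ x ∈ Γ, v' x = v x) (hw : ∀ x ∈ Γ, w' x = w x)
    (hF : ∀ x ∈ Γ, F' x = F x) : StoreRel H Γ v' w' F' :=
  ⟨fun x hx τ hτ => by rw [hv x hx, hw x hx, hF x hx]; exact h.val x hx τ hτ,
    fun x hx τ₁ Δ τ₂ hσ => by rw [hF x hx]; exact h.rfun x hx τ₁ Δ τ₂ hσ,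
    fun x hx y hy hne => by rw [hF x hx, hF y hy]; exact h.sep x hx y hy hne⟩

/-- Adding a variable whose value owns a separate part of the heap. -/
theorem update_append (h : StoreRel H Γ v w F) {x : Var} (hx : x ∉ Γ) {u : Val L} {z : PVal L}
    {G : Set ℕ} (hu : ∀ τ, x.ty = .n τ → VRel H τ u z G)
    (hr : ∀ τ₁ Δ τ₂, x.ty = .rfun τ₁ Δ τ₂ → G = ∅) (hG : ∀ y ∈ Γ, Disjoint G (F y)) :
    StoreRel H (Γ ++ [x]) (Function.update v x u) (Function.update w x z)
      (Function.update F x G) := by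
  have hne {y : Var} (hy : y ∈ Γ) : y ≠ x := fun e => hx (e ▸ hy)
  have hold := h.congr (v' := Function.update v x u) (w' := Function.update w x z)
    (F' := Function.update F x G) (fun y hy => by simp [hne hy]) (fun y hy => by simp [hne hy])
    (fun y hy => by simp [hne hy])
  refine ⟨?_, ?_, ?_⟩
  · intro y hy τ' hτ'
    rcases List.mem_append.1 hy with hy | hy
    · exact hold.val y hy τ' hτ'
    · obtain rfl := List.mem_singleton.1 hy
      simpa using hu τ' hτ'
  · intro y hy τ₁ Δ τ₂ hσ
    rcases List.mem_append.1 hy with hy | hy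
    · exact hold.rfun y hy τ₁ Δ τ₂ hσ
    · obtain rfl := List.mem_singleton.1 hy
      simpa using hr τ₁ Δ τ₂ hσ
  · intro y hy z hz hyz
    rcases List.mem_append.1 hy with hy' | hy' <;> rcases List.mem_append.1 hz with hz' | hz'
    · exact hold.sep y hy' z hz' hyz
    · obtain rfl := List.mem_singleton.1 hz'
      simpa [hne hy'] using (hG y hy').symm
    · obtain rfl := List.mem_singleton.1 hy'
      simpa [hne hz'] using hG z hz'
    · simp_all

end StoreRel

/-- A recursive function does not hold its own store, so it stays related when the captured
variables change in their store components only. Their source values must stay the same, because the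
source closure has captured those. -/
theorem FunsRel.congr {Γ Γ' : TEnv} {v v' : Var → Val L} {w w' : Var → PVal L}
    (h : FunsRel Γ v w) (hΓ : ∀ f ∈ Γ', (∀ τ, f.ty ≠ .n τ) → f ∈ Γ)
    (hf : ∀ f ∈ Γ', (∀ τ, f.ty ≠ .n τ) → v' f = v f ∧ w' f = w f)
    (hΔ : ∀ f ∈ Γ', ∀ τ₁ Δ τ₂, f.ty = .rfun τ₁ Δ τ₂ → ∀ x ∈ NTEnv.toTEnv Δ,
      v' x = v x ∧ x.ty.SameCode (w' x) (w x)) :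
    FunsRel Γ' v' w' := by
  intro f hfΓ τ₁ Δ τ₂ hσ
  have hn : ∀ τ, f.ty ≠ .n τ := by simp [hσ]
  obtain ⟨R, S, hc, hR⟩ := h f (hΓ f hfΓ hn) τ₁ Δ τ₂ hσ
  refine ⟨R, S, ?_, fun x hx => ?_⟩
  · rw [(hf f hfΓ hn).1, (hf f hfΓ hn).2]
    exact hc
  · obtain ⟨h₁, w₀, h₂, h₃⟩ := hR x hx
    obtain ⟨e, hs⟩ := hΔ f hfΓ τ₁ Δ τ₂ hσ x hx
    exact ⟨by rw [h₁, e], w₀, h₂, hs.trans h₃⟩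

/-! ### Two-sided simulation -/

/-- Every outcome on either side is matched by a related outcome on the other. -/
def Sim {α β : Type*} (E : α → Prop) (P : β → Prop) (Q : α → β → Prop) : Prop :=
  (∀ a, E a → ∃ p, P p ∧ Q a p) ∧ ∀ p, P p → ∃ a, E a ∧ Q a p

namespace Sim

variable {α β γ δ : Type*} {E : α → Prop} {P : β → Prop} {Q : α → β → Prop}

theorem congr {E' : α → Prop} {P' : β → Prop} (h : Sim E P Q) (hE : ∀ a, E' a ↔ E a)
    (hP : ∀ p, P' p ↔ P p) : Sim E' P' Q := by
  simpa only [Sim, hE, hP] using h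

/-- For a target with a single outcome. The source may have several, as with the choice of a
location, but it must have at least one. -/
theorem of_unique {p : β} (hE : ∃ a, E a) (hQ : ∀ a, E a → Q a p) (hP : ∀ q, P q ↔ q = p) :
    Sim E P Q := by
  refine ⟨fun a ha => ⟨p, (hP p).2 rfl, hQ a ha⟩, fun q hq => ?_⟩
  obtain rfl := (hP q).1 hq
  obtain ⟨a, ha⟩ := hE
  exact ⟨a, ha, hQ a ha⟩

theorem bind (h : Sim E P Q) {E' : α → γ → Prop} {P' : β → δ → Prop} {Q' : γ → δ → Prop}
    (h' : ∀ a p, Q a p → Sim (E' a) (P' p) Q') :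
    Sim (fun b => ∃ a, E a ∧ E' a b) (fun q => ∃ p, P p ∧ P' p q) Q' := by
  constructor
  · rintro b ⟨a, ha, hb⟩
    obtain ⟨p, hp, hQ⟩ := h.1 a ha
    obtain ⟨q, hq, hQ'⟩ := (h' a p hQ).1 b hb
    exact ⟨q, ⟨p, hp, hq⟩, hQ'⟩
  · rintro q ⟨p, hp, hq⟩
    obtain ⟨a, ha, hQ⟩ := h.2 p hp
    obtain ⟨b, hb, hQ'⟩ := (h' a p hQ).2 q hq
    exact ⟨b, ⟨a, ha, hb⟩, hQ'⟩

theorem map_left (h : Sim E P Q) {g : α → γ} {Q' : γ → β → Prop}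
    (h' : ∀ a p, Q a p → Q' (g a) p) : Sim (fun b => ∃ a, E a ∧ b = g a) P Q' := by
  constructor
  · rintro b ⟨a, ha, rfl⟩
    obtain ⟨p, hp, hQ⟩ := h.1 a ha
    exact ⟨p, hp, h' a p hQ⟩
  · intro p hp
    obtain ⟨a, ha, hQ⟩ := h.2 p hp
    exact ⟨g a, ⟨a, ha, rfl⟩, h' a p hQ⟩

theorem bind_right (h : Sim E P Q) {P' : β → δ → Prop} {Q' : α → δ → Prop}
    (h' : ∀ a p, Q a p → ∃ q, Q' a q ∧ ∀ r, P' p r ↔ r = q) :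
    Sim E (fun q => ∃ p, P p ∧ P' p q) Q' := by
  have := h.bind (E' := fun a b => b = a) (P' := P') (Q' := Q') fun a p hQ => by
    obtain ⟨q, hq, hP⟩ := h' a p hQ
    exact of_unique ⟨a, rfl⟩ (by rintro _ rfl; exact hq) hP
  exact this.congr (fun a => by simp) fun _ => Iff.rfl

end Sim

/-- Continues with `K` after a value, and propagates `FAIL`. -/
def PAns.cont (K : PVal L → PAns L → Prop) : PAns L → PAns L → Prop
  | .fail, a => a = .fail
  | .ok w, a => K w a

theorem PTerm.ev_letE {call : PVal L → PVal L → PAns L → Prop} {S : PEnv L} {x : PVar}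
    {N₁ N₂ : PTerm L} {a : PAns L} :
    (PTerm.letE x N₁ N₂).ev call S a ↔
      ∃ a₁, N₁.ev call S a₁ ∧ a₁.cont (fun w => N₂.ev call (S.set x w)) a := by
  constructor
  · rintro ⟨a₁, h₁, h₂⟩
    exact ⟨a₁, h₁, by cases a₁ <;> exact h₂⟩
  · rintro ⟨a₁, h₁, h₂⟩
    exact ⟨a₁, h₁, by cases a₁ <;> exact h₂⟩

theorem PTerm.ev_app_of_returns {call : PVal L → PVal L → PAns L → Prop} {S : PEnv L} {f : PVar}
    {N : PTerm L} {c w : PVal L} {a : PAns L} (hf : S f = some c) (h : N.Returns call S w) :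
    (PTerm.app f N).ev call S a ↔ call c w a := by
  constructor
  · rintro ⟨a₁, h₁, h₂⟩
    obtain rfl := (h _).1 h₁
    obtain ⟨c', hc, h₂⟩ := h₂
    rw [hf] at hc
    cases hc
    exact h₂
  · exact fun h₂ => ⟨_, (h _).2 rfl, c, hf, h₂⟩

/-! ### Pre- and postconditions -/

/-- The source and target states before the evaluation of a term typed in `Γ`. -/
structure Pre (Γ : TEnv) (H : Heap L) (R : Env L) (S : PEnv L) (v : Var → Val L)
    (w : Var → PVal L) (F : Var → Set ℕ) : Prop where
  fin : H.IsFinite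
  src : ∀ x ∈ Γ, R x = some (v x)
  tgt : ∀ x ∈ Γ, S (.src x) = some (w x)
  store : StoreRel H Γ v w F
  funs : FunsRel Γ v w

/-- The outcomes after the evaluation of a term of type `τ` with environments `Γ` and `Γ'`. The
store in the target may have further components at its end. -/
def Post (Γ : TEnv) (τ : NTy) (Γ' : TEnv) (H : Heap L) (v : Var → Val L) (w : Var → PVal L)
    (F : Var → Set ℕ) : Ans L → PAns L → Prop
  | .ok u R' H', .ok W =>
    ∃ z w' F' G extra, W = .tuple ![z, .tup (Γ'.comps w' ++ extra)] ∧ H'.IsFinite ∧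
      (∀ x ∈ Γ', R' x = some (v x)) ∧ VRel H' τ u z G ∧ StoreRel H' Γ' v w' F' ∧
      (∀ x ∈ Γ', Disjoint G (F' x)) ∧ (∀ x ∈ Γ', x.ty.SameCode (w' x) (w x)) ∧
      Frame H H' (footprint Γ F) (G ∪ footprint Γ' F')
  | .fail, .fail => True
  | _, _ => False

/-- The outcomes after a call of a function with captured environment `Δ`. -/
def CallPost (τ₁ : NTy) (Δ : NTEnv) (τ₂ : NTy) (H : Heap L) (v : Var → Val L) (w : Var → PVal L)
    (F : Var → Set ℕ) (u₁ : Val L) (z₁ : PVal L) (G₁ : Set ℕ) : Ans L → PAns L → Prop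
  | .ok u _ H', .ok W =>
    ∃ z z₁' w' G G₁' F', W = .tuple ![z, z₁', .tup (Δ.toTEnv.comps w')] ∧ H'.IsFinite ∧
      VRel H' τ₂ u z G ∧ VRel H' τ₁ u₁ z₁' G₁' ∧ StoreRel H' Δ.toTEnv v w' F' ∧
      Disjoint G G₁' ∧ (∀ x ∈ Δ.toTEnv, Disjoint G (F' x)) ∧
      (∀ x ∈ Δ.toTEnv, Disjoint G₁' (F' x)) ∧ (FTy.n τ₁).SameCode z₁' z₁ ∧
      (∀ x ∈ Δ.toTEnv, x.ty.SameCode (w' x) (w x)) ∧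
      Frame H H' (G₁ ∪ footprint Δ.toTEnv F) (G ∪ G₁' ∪ footprint Δ.toTEnv F')
  | .fail, .fail => True
  | _, _ => False

/-- Calls of related functions with related arguments have related outcomes. -/
def CallSim (call : Val L → Val L → Heap L → Ans L → Prop)
    (pcall : PVal L → PVal L → PAns L → Prop) : Prop :=
  ∀ ⦃τ₁ Δ τ₂ u R c S v w F u₁ z₁ G₁⦄ ⦃H : Heap L⦄, H.IsFinite → CodeRel τ₁ Δ τ₂ u R c S →
    Captures Δ R S v w → StoreRel H Δ.toTEnv v w F → VRel H τ₁ u₁ z₁ G₁ →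
    (∀ x ∈ Δ.toTEnv, Disjoint G₁ (F x)) →
    Sim (call u u₁ H) (pcall c (.tuple ![z₁, .tup (Δ.toTEnv.comps w)]))
      (CallPost τ₁ Δ τ₂ H v w F u₁ z₁ G₁)

/-- The variables captured by the recursive functions in `Γ` are in `Γ'`. -/
def Live (Γ Γ' : TEnv) : Prop :=
  ∀ f ∈ Γ, ∀ τ₁ Δ τ₂, f.ty = .rfun τ₁ Δ τ₂ → ∀ x ∈ NTEnv.toTEnv Δ, x ∈ Γ'

theorem VRel.exists_of_ref {H : Heap L} {ρ : RTy} {v : Val L} {w : PVal L} {F : Set ℕ}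
    (h : VRel H (.r (.ref ρ)) v w F) :
    ∃ ℓ a G, v = .atom (.loc ℓ) ∧ H ℓ = some a ∧ VRel H (.r ρ) (.atom a) w G ∧ ℓ ∉ G ∧
      F = insert ℓ G := by
  cases h with
  | ref hℓ h hF => exact ⟨_, _, _, rfl, hℓ, h, hF, rfl⟩

theorem VRel.exists_atom {H : Heap L} {ρ : RTy} {v : Val L} {w : PVal L} {F : Set ℕ}
    (h : VRel H (.r ρ) v w F) : ∃ a, v = .atom a := by
  cases h <;> exact ⟨_, rfl⟩

theorem VRel.exists_const {H : Heap L} {v : Val L} {w : PVal L} {F : Set ℕ}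
    (h : VRel H .b v w F) : ∃ c, v = .atom (.const c) ∧ w = .const c := by
  cases h
  exact ⟨_, rfl, rfl⟩

theorem footprint_mono {Γ Γ' : TEnv} {F : Var → Set ℕ} (h : ∀ x ∈ Γ', x ∈ Γ) :
    footprint Γ' F ⊆ footprint Γ F :=
  fun _ ⟨x, hx, hℓ⟩ => ⟨x, h x hx, hℓ⟩

theorem subset_footprint {Γ : TEnv} {F : Var → Set ℕ} {x : Var} (hx : x ∈ Γ) :
    F x ⊆ footprint Γ F :=
  fun _ hℓ => ⟨x, hx, hℓ⟩

theorem footprint_congr {Γ : TEnv} {F F' : Var → Set ℕ} (h : ∀ x ∈ Γ, F x = F' x) :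
    footprint Γ F = footprint Γ F' := by
  ext ℓ
  exact exists_congr fun x => and_congr_right fun hx => by rw [h x hx]

theorem footprint_append_update {Γ : TEnv} {F : Var → Set ℕ} {x : Var} (hx : x ∉ Γ) (G : Set ℕ) :
    footprint (Γ ++ [x]) (Function.update F x G) = G ∪ footprint Γ F := by
  have hne {y : Var} (hy : y ∈ Γ) : y ≠ x := fun e => hx (e ▸ hy)
  ext ℓ
  constructor
  · rintro ⟨y, hy, hℓ⟩
    rcases List.mem_append.1 hy with hy | hy
    · exact .inr ⟨y, hy, by simpa [hne hy] using hℓ⟩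
    · obtain rfl := List.mem_singleton.1 hy
      exact .inl (by simpa using hℓ)
  · rintro (hℓ | ⟨y, hy, hℓ⟩)
    · exact ⟨x, by simp, by simpa using hℓ⟩
    · exact ⟨y, by simp [hy], by simpa [hne hy] using hℓ⟩

/-- A change of the heap confined to the variables in `T` leaves the others related. -/
theorem StoreRel.frame {H H' : Heap L} {Γ T : TEnv} {v : Var → Val L} {w w' : Var → PVal L}
    {F F' : Var → Set ℕ} {G : Set ℕ} (h : StoreRel H Γ v w F) (hT : ∀ x ∈ T, x ∈ Γ)
    (h' : StoreRel H' T v w' F') (hw : ∀ x ∈ Γ, x ∉ T → w' x = w x ∧ F' x = F x)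
    (hfr : Frame H H' (footprint T F) (G ∪ footprint T F'))
    (hG : ∀ x ∈ T, Disjoint G (F' x)) :
    StoreRel H' Γ v w' F' ∧ (∀ x ∈ Γ, Disjoint G (F' x)) ∧
      Frame H H' (footprint Γ F) (G ∪ footprint Γ F') := by
  have hout {x : Var} (hx : x ∈ Γ) (hxT : x ∉ T) : ∀ ℓ ∈ F x, ℓ ∉ footprint T F := by
    rintro ℓ hℓ ⟨y, hy, hm⟩
    exact Set.disjoint_left.1 (h.sep x hx y (hT y hy) fun e => hxT (e ▸ hy)) hℓ hm
  -- What `T` and the result own afterwards was owned by `T` before or was not allocated, so it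
  -- cannot meet the cells of a variable outside `T`.
  have hnew {x : Var} (hx : x ∈ Γ) (hxT : x ∉ T) : ∀ ℓ ∈ F x, ℓ ∉ G ∪ footprint T F' := by
    intro ℓ hℓ hm
    rcases hfr.sub ℓ hm with h₁ | h₁
    exacts [hout hx hxT ℓ hℓ h₁, h.ne_none hx ℓ hℓ h₁]
  refine ⟨⟨fun x hx τ hτ => ?_, fun x hx τ₁ Δ τ₂ hσ => ?_, fun x hx y hy hne => ?_⟩,
    fun x hx => ?_, ⟨fun ℓ hℓ => hfr.eq ℓ fun hm => hℓ (footprint_mono hT hm), ?_⟩⟩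
  · by_cases hxT : x ∈ T
    · exact h'.val x hxT τ hτ
    · rw [(hw x hx hxT).1, (hw x hx hxT).2]
      exact (h.val x hx τ hτ).congr_heap fun ℓ hℓ =>
        hfr.eq ℓ (hout hx hxT ℓ hℓ) (h.ne_none hx ℓ hℓ)
  · by_cases hxT : x ∈ T
    · exact h'.rfun x hxT τ₁ Δ τ₂ hσ
    · rw [(hw x hx hxT).2]
      exact h.rfun x hx τ₁ Δ τ₂ hσ
  · by_cases hxT : x ∈ T <;> by_cases hyT : y ∈ T
    · exact h'.sep x hxT y hyT hne
    · rw [(hw y hy hyT).2]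
      exact Set.disjoint_right.2 fun ℓ hℓ hm => hnew hy hyT ℓ hℓ (.inr ⟨x, hxT, hm⟩)
    · rw [(hw x hx hxT).2]
      exact Set.disjoint_left.2 fun ℓ hℓ hm => hnew hx hxT ℓ hℓ (.inr ⟨y, hyT, hm⟩)
    · rw [(hw x hx hxT).2, (hw y hy hyT).2]
      exact h.sep x hx y hy hne
  · by_cases hxT : x ∈ T
    · exact hG x hxT
    · rw [(hw x hx hxT).2]
      exact Set.disjoint_right.2 fun ℓ hℓ hm => hnew hx hxT ℓ hℓ (.inl hm)
  · rintro ℓ (hm | ⟨x, hx, hm⟩)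
    · exact (hfr.sub ℓ (.inl hm)).imp_left fun h => footprint_mono hT h
    · by_cases hxT : x ∈ T
      · exact (hfr.sub ℓ (.inr ⟨x, hxT, hm⟩)).imp_left fun h => footprint_mono hT h
      · rw [(hw x hx hxT).2] at hm
        exact .inl ⟨x, hx, hm⟩

/-! ### Simulation of terms that evaluate no subterm and make no call -/

section Leaves

variable {Γ Γ' : TEnv} {H : Heap L} {R : Env L} {S : PEnv L} {v : Var → Val L}
  {w : Var → PVal L} {F : Var → Set ℕ} {call : Val L → Val L → Heap L → Ans L → Prop}
  {pcall : PVal L → PVal L → PAns L → Prop}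

theorem Pre.returns_pack (h : Pre Γ H R S v w F) (hΓ : ∀ x ∈ Γ', x ∈ Γ) :
    (pack Γ').Returns pcall S (.tup (TEnv.comps Γ' w)) :=
  PTerm.returns_pack (fun x hx => h.tgt x (hΓ x hx)) fun x hx => h.store.shaped x (hΓ x hx)

/-- Outcomes where only new locations have been written. -/
theorem Pre.post (h : Pre Γ H R S v w F) (hΓ : ∀ x ∈ Γ', x ∈ Γ) {τ : NTy} {u : Val L} {z : PVal L}
    {G : Set ℕ} {R' : Env L} {H' : Heap L} (hfin : H'.IsFinite)
    (hH : ∀ ℓ, H ℓ ≠ none → H' ℓ = H ℓ) (hR : ∀ x ∈ Γ', R' x = R x) (hu : VRel H' τ u z G)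
    (hG : ∀ x ∈ Γ', Disjoint G (F x)) (hGF : ∀ ℓ ∈ G, ℓ ∈ footprint Γ F ∨ H ℓ = none) :
    Post Γ τ Γ' H v w F (.ok u R' H') (.ok (.tuple ![z, .tup (TEnv.comps Γ' w)])) := by
  refine ⟨z, w, F, G, [], by rw [List.append_nil], hfin,
    fun x hx => by rw [hR x hx, h.src x (hΓ x hx)], hu, ?_, hG,
    fun x hx => (h.store.shaped x (hΓ x hx)).sameCode_refl, fun ℓ _ => hH ℓ, ?_⟩
  · have := h.store.subset hΓ
    exact ⟨fun x hx τ hτ => (this.val x hx τ hτ).congr_heap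
      fun ℓ hℓ => hH ℓ (this.ne_none hx ℓ hℓ), this.rfun, this.sep⟩
  · rintro ℓ (hℓ | hℓ)
    · exact hGF ℓ hℓ
    · exact .inl (footprint_mono hΓ hℓ)

theorem Pre.post_const (h : Pre Γ H R S v w F) {τ : NTy} {u : Val L} {z : PVal L}
    (hu : VRel H τ u z ∅) :
    Post Γ τ Γ H v w F (.ok u R H) (.ok (.tuple ![z, .tup (TEnv.comps Γ w)])) :=
  h.post (fun _ hx => hx) h.fin (fun _ _ => rfl) (fun _ _ => rfl) hu (by simp) (by simp)

theorem Env.excTy_of_mem {x y : Var} {σ : FTy} (hy : y ∈ Γ.excTy x σ) : R.excTy x σ y = R y := by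
  obtain ⟨-, hy⟩ := TEnv.mem_excTy.1 hy
  unfold Env.excTy
  split
  · rfl
  · simp_all [Env.erase]

theorem Env.exc_of_mem {x y : Var} (hy : y ∈ Γ.exc x) : R.exc x y = R y :=
  Env.excTy_of_mem hy

/-- A variable is used up unless it is sharable, and then it owns nothing; hence its cells can be
handed over. -/
theorem StoreRel.disjoint_of_mem_exc (h : StoreRel H Γ v w F) {x y : Var} (hx : x ∈ Γ)
    (hy : y ∈ Γ.exc x) : Disjoint (F x) (F y) := by
  obtain ⟨hy, hs | hne⟩ := TEnv.mem_exc.1 hy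
  · rw [h.eq_empty hx hs]
    exact Set.empty_disjoint _
  · exact h.sep x hx y hy hne.symm

theorem Pre.sim_var (h : Pre Γ H R S v w F) {x : Var} {τ : NTy} (hx : Γ.Has x (.n τ)) :
    Sim ((Term.var x).ev call R H) ((pair (PTerm.v x) (pack (Γ.exc x))).ev pcall S)
      (Post Γ τ (Γ.exc x) H v w F) := by
  have hΓ : ∀ y ∈ Γ.exc x, y ∈ Γ := fun y hy => (TEnv.mem_exc.1 hy).1
  refine .of_unique ⟨_, _, h.src x hx.1, rfl⟩ ?_
    (returns_pair (returns_var (h.tgt x hx.1)) (h.returns_pack hΓ))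
  rintro _ ⟨u, hu, rfl⟩
  obtain rfl : v x = u := by simpa [h.src x hx.1] using hu
  exact h.post hΓ h.fin (fun _ _ => rfl) (fun _ hy => Env.exc_of_mem hy)
    (h.store.val x hx.1 τ hx.2) (fun y hy => h.store.disjoint_of_mem_exc hx.1 hy)
    fun ℓ hℓ => .inl ⟨x, hx.1, hℓ⟩

theorem Pre.sim_op (h : Pre Γ H R S v w F) {k : ℕ} {o : L.Op k} {xs : Fin k → Var}
    (hxs : ∀ i, Γ.Has (xs i) (.n .b)) :
    Sim ((Term.op o xs).ev call R H) ((pair (.op o fun i => .src (xs i)) (pack Γ)).ev pcall S)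
      (Post Γ .b Γ H v w F) := by
  choose cs hv hw using fun i => (h.store.val _ (hxs i).1 _ (hxs i).2).exists_const
  refine .of_unique (p := .ok (.tuple ![.const (L.sem o cs), .tup (TEnv.comps Γ w)]))
    ⟨_, cs, fun i => by rw [h.src _ (hxs i).1, hv], rfl⟩ ?_
    (returns_pair (fun a => ?_) (h.returns_pack fun _ hx => hx))
  · rintro _ ⟨cs', hcs, rfl⟩
    obtain rfl : cs' = cs := funext fun i => by
      have := (hcs i).symm.trans (h.src _ (hxs i).1)
      rw [hv] at this
      simpa using this
    exact h.post_const (.const _)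
  · constructor
    · rintro ⟨cs', hcs, rfl⟩
      obtain rfl : cs' = cs := funext fun i => by
        have := (hcs i).symm.trans (h.tgt _ (hxs i).1)
        rw [hw] at this
        simpa using this
      rfl
    · rintro rfl
      exact ⟨cs, fun i => by rw [h.tgt _ (hxs i).1, hw], rfl⟩

/-- A reference and its contents have the same target value, so the target has nothing to do. The
result owns the cells of `x` except the outermost; if `x` stays, the contents are sharable and own
nothing. -/
theorem Pre.sim_deref (h : Pre Γ H R S v w F) {x : Var} {ρ : RTy}
    (hx : Γ.Has x (.n (.r (.ref ρ)))) :
    Sim ((Term.deref x).ev call R H)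
      ((pair (PTerm.v x) (pack (Γ.excTy x (.n (.r ρ))))).ev pcall S)
      (Post Γ (.r ρ) (Γ.excTy x (.n (.r ρ))) H v w F) := by
  have hΓ : ∀ y ∈ Γ.excTy x (.n (.r ρ)), y ∈ Γ := fun y hy => (TEnv.mem_excTy.1 hy).1
  obtain ⟨ℓ, b, G, hv, hℓ, hb, -, hF⟩ := (h.store.val x hx.1 _ hx.2).exists_of_ref
  refine .of_unique ⟨_, ρ, ℓ, b, hx.2, by rw [h.src x hx.1, hv], hℓ, rfl⟩ ?_
    (returns_pair (returns_var (h.tgt x hx.1)) (h.returns_pack hΓ))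
  rintro _ ⟨ρ', ℓ', b', hρ, hu, hℓ', rfl⟩
  obtain rfl : ρ = ρ' := by simpa using hx.2.symm.trans hρ
  obtain rfl : ℓ = ℓ' := by simpa [h.src x hx.1, hv] using hu
  obtain rfl : b = b' := by simpa [hℓ] using hℓ'
  refine h.post hΓ h.fin (fun _ _ => rfl) (fun _ hy => Env.excTy_of_mem hy) hb (fun y hy => ?_)
    fun m hm => .inl ⟨x, hx.1, by rw [hF]; exact .inr hm⟩
  obtain ⟨hy, hs | hne⟩ := TEnv.mem_excTy.1 hy
  · rw [hb.eq_empty (NTy.size_eq_zero_of_sharable hs)]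
    exact Set.empty_disjoint _
  · exact (h.store.sep x hx.1 y hy hne.symm).mono_left (by rw [hF]; exact Set.subset_insert _ _)

/-- The target value is unchanged; only ownership grows, by the new location, which is in no
footprint because owned locations are allocated. -/
theorem Pre.sim_mkref (h : Pre Γ H R S v w F) {x : Var} {ρ : RTy} (hx : Γ.Has x (.n (.r ρ))) :
    Sim ((Term.mkref x).ev call R H) ((pair (PTerm.v x) (pack (Γ.exc x))).ev pcall S)
      (Post Γ (.r (.ref ρ)) (Γ.exc x) H v w F) := by
  have hΓ : ∀ y ∈ Γ.exc x, y ∈ Γ := fun y hy => (TEnv.mem_exc.1 hy).1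
  have hx' := h.store.val x hx.1 _ hx.2
  obtain ⟨b, hb⟩ := hx'.exists_atom
  obtain ⟨ℓ₀, hℓ₀⟩ := h.fin.exists_fresh
  refine .of_unique ⟨_, ℓ₀, b, by rw [h.src x hx.1, hb], hℓ₀, rfl⟩ ?_
    (returns_pair (returns_var (h.tgt x hx.1)) (h.returns_pack hΓ))
  rintro _ ⟨ℓ, b', hb', hℓ, rfl⟩
  obtain rfl : b = b' := by simpa [h.src x hx.1, hb] using hb'
  have hH : ∀ m, H m ≠ none → H.set ℓ b m = H m := fun m hm => by
    have : m ≠ ℓ := fun e => hm (e ▸ hℓ)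
    simp [Heap.set, this]
  refine h.post (G := insert ℓ (F x)) hΓ (h.fin.set ℓ b) hH (fun _ hy => Env.exc_of_mem hy)
    (.ref (a := b) (by simp [Heap.set]) ?_ fun hm => hx'.ne_none ℓ hm hℓ) (fun y hy => ?_) ?_
  · rw [hb] at hx'
    exact hx'.congr_heap fun m hm => hH m (hx'.ne_none m hm)
  · rw [Set.disjoint_insert_left]
    exact ⟨fun hm => h.store.ne_none (hΓ y hy) ℓ hm hℓ, h.store.disjoint_of_mem_exc hx.1 hy⟩
  · rintro m (rfl | hm)
    exacts [.inr hℓ, .inl ⟨x, hx.1, hm⟩]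

theorem Pre.sim_assign (h : Pre Γ H R S v w F) {x y : Var} {ρ : RTy}
    (hy : Γ.Has y (.n (.r (.ref ρ)))) (hx : Γ.Has x (.n (.r ρ))) :
    Sim ((Term.assign y x).ev call R H)
      ((PTerm.letE (.src y) (PTerm.v x) (pair .unit (pack (Γ.exc x)))).ev pcall S)
      (Post Γ .unit (Γ.exc x) H v w F) := by
  have hΓ : ∀ z ∈ Γ.exc x, z ∈ Γ := fun y hy => (TEnv.mem_exc.1 hy).1
  have hx' := h.store.val x hx.1 _ hx.2
  obtain ⟨b, hb⟩ := hx'.exists_atom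
  obtain ⟨ℓ, b₀, G₀, hv, hℓ, -, -, hF⟩ := (h.store.val y hy.1 _ hy.2).exists_of_ref
  -- Otherwise `ρ` would equal `ref ρ`, contradicting the size of types.
  have hyx : y ≠ x := by
    rintro rfl
    have := hy.2.symm.trans hx.2
    simp only [FTy.n.injEq, NTy.r.injEq] at this
    exact absurd (congrArg sizeOf this) (by simp)
  have hℓx : ℓ ∉ F x := Set.disjoint_left.1 (h.store.sep y hy.1 x hx.1 hyx) (by rw [hF]; simp)
  have hH {m : ℕ} (hm : m ≠ ℓ) : H.set ℓ b m = H m := by simp [Heap.set, hm]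
  -- The variable `y` keeps its location `ℓ`, takes over the cells of `x` and gives up those of its
  -- former contents. Separation survives, since `x` either leaves the environment or owns nothing.
  have hstore : StoreRel (H.set ℓ b) (Γ.exc x) v (Function.update w y (w x))
      (Function.update F y (insert ℓ (F x))) := by
    have hout {z : Var} (hz : z ∈ Γ) (hzy : z ≠ y) : ℓ ∉ F z :=
      Set.disjoint_left.1 (h.store.sep y hy.1 z hz hzy.symm) (by rw [hF]; simp)
    have hdis {z : Var} (hz : z ∈ Γ.exc x) (hzy : z ≠ y) : Disjoint (insert ℓ (F x)) (F z) := by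
      rw [Set.disjoint_insert_left]
      exact ⟨hout (hΓ z hz) hzy, h.store.disjoint_of_mem_exc hx.1 hz⟩
    refine ⟨fun z hz τ hτ => ?_, fun z hz τ₁ Δ τ₂ hσ => ?_, fun z hz z' hz' hne => ?_⟩
    · by_cases hzy : z = y
      · subst hzy
        obtain rfl : NTy.r (.ref ρ) = τ := by simpa using hy.2.symm.trans hτ
        rw [Function.update_self, Function.update_self, hv]
        refine .ref (a := b) (by simp [Heap.set]) ?_ hℓx
        rw [hb] at hx'
        exact hx'.congr_heap fun m hm => hH fun e => hℓx (e ▸ hm)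
      · rw [Function.update_of_ne hzy, Function.update_of_ne hzy]
        exact (h.store.val z (hΓ z hz) τ hτ).congr_heap
          fun m hm => hH fun e => hout (hΓ z hz) hzy (e ▸ hm)
    · rw [Function.update_of_ne (by rintro rfl; cases hσ.symm.trans hy.2)]
      exact h.store.rfun z (hΓ z hz) τ₁ Δ τ₂ hσ
    · by_cases hzy : z = y
      · subst hzy
        rw [Function.update_self, Function.update_of_ne hne.symm]
        exact hdis hz' hne.symm
      · by_cases hzy' : z' = y
        · subst hzy'
          rw [Function.update_self, Function.update_of_ne hne]
          exact (hdis hz hne).symm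
        · rw [Function.update_of_ne hzy, Function.update_of_ne hzy']
          exact h.store.sep z (hΓ z hz) z' (hΓ z' hz') hne
  refine .of_unique ⟨_, ℓ, b, by rw [h.src y hy.1, hv], by rw [h.src x hx.1, hb], rfl⟩ ?_
    fun a => (ev_letE_of_returns (returns_var (h.tgt x hx.1))).trans
      (returns_pair (w₁ := .unit)
        (w₂ := .tup (TEnv.comps (Γ.exc x) (Function.update w y (w x)))) (fun _ => Iff.rfl)
        (PTerm.returns_pack (fun z hz => ?_) hstore.shaped) a)
  · rintro _ ⟨ℓ', b', hℓ', hb', rfl⟩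
    obtain rfl : ℓ = ℓ' := by simpa [h.src y hy.1, hv] using hℓ'
    obtain rfl : b = b' := by simpa [h.src x hx.1, hb] using hb'
    refine ⟨.unit, _, _, ∅, [], by rw [List.append_nil], h.fin.set ℓ b,
      fun z hz => by rw [Env.exc_of_mem hz, h.src z (hΓ z hz)], .unit, hstore, by simp,
      fun z hz => ?_, fun m hm _ => hH ?_, ?_⟩
    · by_cases hzy : z = y
      · subst hzy
        rw [hy.2]
        trivial
      · rw [Function.update_of_ne hzy]
        exact (h.store.shaped z (hΓ z hz)).sameCode_refl
    · rintro rfl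
      exact hm ⟨y, hy.1, by rw [hF]; simp⟩
    · rintro m (hm | ⟨z, hz, hm⟩)
      · exact hm.elim
      · by_cases hzy : z = y
        · subst hzy
          rw [Function.update_self] at hm
          rcases hm with rfl | hm
          exacts [.inl ⟨z, hy.1, by rw [hF]; simp⟩, .inl ⟨x, hx.1, hm⟩]
        · rw [Function.update_of_ne hzy] at hm
          exact .inl ⟨z, hΓ z hz, hm⟩
  · by_cases hzy : z = y
    · subst hzy
      rw [PEnv.set_same, Function.update_self]
    · rw [PEnv.set_ne _ (by simpa using hzy), Function.update_of_ne hzy, h.tgt z (hΓ z hz)]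

/-- A new function value captures the bindings of its free variables. -/
theorem Pre.sim_fun (h : Pre Γ H R S v w F) {s : Finset Var} {Δ : NTEnv}
    (hs : (Δ.toTEnv, Γ') = Γ.split s) {τ₁ τ₂ : NTy} {u : Val L} {c : PVal L} {P : PTerm L}
    {M : Term L}
    (hu : CodeRel τ₁ Δ τ₂ u (R.split s).1 c S) (hP : P.Returns pcall S c)
    (hM : ∀ a, M.ev call R H a ↔ a = .ok u (R.split s).2 H) :
    Sim (M.ev call R H) ((pair (closure P (pack Δ.toTEnv)) (pack Γ')).ev pcall S)
      (Post Γ (.fn τ₁ Δ.size τ₂) Γ' H v w F) := by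
  obtain ⟨hΔ, rfl⟩ := Prod.mk.inj hs
  have hmem {x : Var} : x ∈ Δ.toTEnv ↔ x ∈ Γ ∧ x ∈ s := by
    rw [hΔ]
    simp
  have hΔΓ : ∀ x ∈ Δ.toTEnv, x ∈ Γ := fun x hx => (hmem.1 hx).1
  have hΓ : ∀ x ∈ Γ.filter (fun x => x ∉ s ∨ x.ty.sharable), x ∈ Γ :=
    fun x hx => (List.mem_filter.1 hx).1
  refine .of_unique ⟨_, (hM _).2 rfl⟩ ?_
    (returns_pair (returns_closure hP (h.returns_pack hΔΓ)) (h.returns_pack hΓ))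
  intro a ha
  obtain rfl := (hM a).1 ha
  have hst := h.store.subset hΔΓ
  refine h.post hΓ h.fin (fun _ _ => rfl) (fun x hx => ?_)
    (.fn hu (fun x hx => ⟨?_, w x, h.tgt x (hΔΓ x hx), (hst.shaped x hx).sameCode_refl⟩)
      hst.val hst.sep) (fun x hx => ?_) fun ℓ hℓ => .inl (footprint_mono hΔΓ hℓ)
  · have := (List.mem_filter.1 hx).2
    simp only [decide_eq_true_eq] at this
    simp only [Env.split]
    rw [if_pos this]
  · simp only [Env.split]
    rw [if_pos (hmem.1 hx).2, h.src x (hΔΓ x hx)]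
  · obtain ⟨hxΓ, hx'⟩ := List.mem_filter.1 hx
    simp only [decide_eq_true_eq] at hx'
    rcases hx' with hxs | hsh
    -- A remaining variable is either not captured, hence separate from all captured ones, or
    -- sharable and without cells.
    · refine Set.disjoint_left.2 ?_
      rintro ℓ ⟨y, hy, hℓ⟩ hm
      have hne : y ≠ x := by
        rintro rfl
        exact hxs (hmem.1 hy).2
      exact Set.disjoint_left.1 (h.store.sep y (hΔΓ y hy) x hxΓ hne) hℓ hm
    · rw [h.store.eq_empty hxΓ hsh]
      exact Set.disjoint_empty _

end Leaves

/-! ### Simulation of compound terms -/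

/-- Continues with `K` after a value, and propagates `FAIL`. -/
def Ans.cont (K : Val L → Env L → Heap L → Ans L → Prop) : Ans L → Ans L → Prop
  | .fail, a => a = .fail
  | .ok v R H, a => K v R H a

theorem Term.ev_letE {call : Val L → Val L → Heap L → Ans L → Prop} {R : Env L} {H : Heap L}
    {x : Var} {M₁ M₂ : Term L} {a : Ans L} :
    (Term.letE x M₁ M₂).ev call R H a ↔
      ∃ a₁, M₁.ev call R H a₁ ∧ a₁.cont (fun v R₁ H₁ a =>
        ∃ a₂, M₂.ev call (R₁.set x v) H₁ a₂ ∧ a = a₂.mapEnv (·.erase x)) a := by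
  constructor
  · rintro ⟨a₁, h₁, h₂⟩
    exact ⟨a₁, h₁, by cases a₁ <;> exact h₂⟩
  · rintro ⟨a₁, h₁, h₂⟩
    exact ⟨a₁, h₁, by cases a₁ <;> exact h₂⟩

theorem PTerm.ev_split₃ {call : PVal L → PVal L → PAns L → Prop} {x y z : PVar} {N : PTerm L}
    {S : PEnv L} {a : PAns L} {w₁ w₂ w₃ : PVal L}
    (hp : S .p = some (.tuple ![w₁, w₂, w₃])) (hx : .p ≠ x) (hy : .p ≠ y) :
    (PTerm.letE x (.proj (.var .p) 0) (.letE y (.proj (.var .p) 1)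
      (.letE z (.proj (.var .p) 2) N))).ev call S a ↔
      N.ev call (((S.set x w₁).set y w₂).set z w₃) a := by
  have hp₁ := (PEnv.set_ne S hx w₁).trans hp
  have hp₂ := (PEnv.set_ne (S.set x w₁) hy w₂).trans hp₁
  rw [ev_letE_of_returns (returns_proj (returns_var hp) (j := 0) (by omega)),
    ev_letE_of_returns (w := w₂) (returns_proj (returns_var hp₁) (j := 1) (by omega)),
    ev_letE_of_returns (w := w₃) (returns_proj (returns_var hp₂) (j := 2) (by omega))]
  rfl

theorem footprint_append (Γ Γ' : TEnv) (F : Var → Set ℕ) :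
    footprint (Γ ++ Γ') F = footprint Γ F ∪ footprint Γ' F := by
  ext ℓ
  simp only [footprint, List.mem_append, Set.mem_ofPred_eq, Set.mem_union, or_and_right, exists_or]

theorem footprint_singleton (x : Var) (F : Var → Set ℕ) : footprint [x] F = F x := by
  ext ℓ
  simp [footprint]

/-- Captured environments are normal, so the clause of `StoreRel` on recursive functions is vacuous.
-/
theorem VRel.exists_of_fn {H : Heap L} {τ₁ τ₂ : NTy} {m : ℕ} {u : Val L} {z : PVal L} {G : Set ℕ}
    (h : VRel H (.fn τ₁ m τ₂) u z G) :
    ∃ Δ R c S v w F, m = NTEnv.size Δ ∧ CodeRel τ₁ Δ τ₂ u R c S ∧ Captures Δ R S v w ∧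
      StoreRel H Δ.toTEnv v w F ∧ z = .closure (Δ.toTEnv.comps w) c ∧
      G = footprint Δ.toTEnv F := by
  cases h with
  | fn hc hR hv hF =>
    refine ⟨_, _, _, _, _, _, _, rfl, hc, hR, ⟨hv, fun x hx _ _ _ hσ => ?_, hF⟩, rfl, rfl⟩
    obtain ⟨τ, hτ⟩ := NTEnv.exists_ty_of_mem hx
    cases hτ.symm.trans hσ

section Compound

variable {Γ Γ' : TEnv} {H : Heap L} {R : Env L} {S : PEnv L} {v : Var → Val L}
  {w : Var → PVal L} {F : Var → Set ℕ} {call : Val L → Val L → Heap L → Ans L → Prop}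
  {pcall : PVal L → PVal L → PAns L → Prop}

/-- The postcondition for `M₁`, after unpacking, is the precondition for `M₂`. Postconditions do not
mention recursive functions: their relation is rebuilt here from the one for `Γ`, since captured
variables keep their source values and their code. -/
theorem Pre.sim_let (h : Pre Γ H R S v w F) {Γ'' : TEnv} {x : Var} {τ τ' : NTy}
    {M₁ M₂ : Term L} {N₁ N₂ : PTerm L} (hx : x.ty = .n τ') (hsub : ∀ y ∈ Γ'', y ∈ Γ)
    (hnd : (Γ'' ++ [x]).Nodup) (hsub' : Γ'.Sublist (Γ'' ++ [x])) (hl : Live Γ (Γ'.erase x))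
    (ih₁ : Sim (M₁.ev call R H) (N₁.ev pcall S) (Post Γ τ' Γ'' H v w F))
    (ih₂ : ∀ {H R S v w F}, Pre (Γ'' ++ [x]) H R S v w F →
      Sim (M₂.ev call R H) (N₂.ev pcall S) (Post (Γ'' ++ [x]) τ Γ' H v w F)) :
    Sim ((Term.letE x M₁ M₂).ev call R H)
      ((letPair (.src x) .h N₁ (unpack Γ'' N₂)).ev pcall S)
      (Post Γ τ (Γ'.erase x) H v w F) := by
  have hx'' : x ∉ Γ'' := TEnv.notMem_of_nodup_append hnd
  have hnd'' : Γ''.Nodup := (List.nodup_append.1 hnd).1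
  have hne {y : Var} (hy : y ∈ Γ'') : y ≠ x := fun e => hx'' (e ▸ hy)
  obtain ⟨hsub₁, Γ₁, hΓ₁⟩ := TEnv.eq_erase_append hx'' hsub'
  refine (ih₁.bind ?_).congr (fun _ => Term.ev_letE) fun _ => PTerm.ev_letE
  intro a p hQ
  rcases a with ⟨u, R₁, H₁⟩ | _ <;> rcases p with W | _
  case ok.fail | fail.ok => exact hQ.elim
  case fail.fail =>
    exact .of_unique (p := .fail) ⟨_, rfl⟩ (by rintro _ rfl; trivial) fun _ => Iff.rfl
  obtain ⟨z, w', F', G, extra, rfl, hfin, hR, hu, hst, hG, hcode, hfr⟩ := hQ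
  have hpre : Pre (Γ'' ++ [x]) H₁ (R₁.set x u)
      ((((S.set .p (.tuple ![z, .tup (Γ''.comps w' ++ extra)])).set (.src x) z).set .h
        (.tup (Γ''.comps w' ++ extra))).rebind Γ'' w')
      (Function.update v x u) (Function.update w' x z) (Function.update F' x G) := by
    refine ⟨hfin, fun y hy => ?_, fun y hy => ?_, hst.update_append hx'' ?_ ?_ hG, ?_⟩
    · rcases List.mem_append.1 hy with hy | hy
      · rw [Function.update_of_ne (hne hy), Env.set, Function.update_of_ne (hne hy), hR y hy]
      · obtain rfl := List.mem_singleton.1 hy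
        rw [Function.update_self, Env.set, Function.update_self]
    · rcases List.mem_append.1 hy with hy | hy
      · rw [Function.update_of_ne (hne hy), PEnv.rebind_mem hy]
      · obtain rfl := List.mem_singleton.1 hy
        rw [Function.update_self, PEnv.rebind_notMem hx'', PEnv.set_ne _ (by simp), PEnv.set_same]
    · intro τ'' hτ''
      obtain rfl : τ' = τ'' := by simpa using hx.symm.trans hτ''
      exact hu
    · intro τ₁ Δ τ₂ hσ
      cases hx.symm.trans hσ
    · have hmem {f : Var} (hf : f ∈ Γ'' ++ [x]) (hn : ∀ τ, f.ty ≠ .n τ) : f ∈ Γ'' := by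
        rcases List.mem_append.1 hf with hf | hf
        · exact hf
        · exact absurd hx (List.mem_singleton.1 hf ▸ hn τ')
      refine h.funs.congr (fun f hf hn => hsub f (hmem hf hn)) (fun f hf hn => ?_)
        fun f hf τ₁ Δ τ₂ hσ y hy => ?_
      · have hf' := hmem hf hn
        rw [Function.update_of_ne (hne hf'), Function.update_of_ne (hne hf')]
        refine ⟨rfl, ?_⟩
        have := hcode f hf'
        cases hσ : f.ty with
        | n τ => exact absurd hσ (hn τ)
        | rfun τ₁ Δ τ₂ => rwa [hσ] at this
      -- The captured `y` is in the final environment, so `M₁` has not consumed it and it is not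
      -- `x`. Well-formedness of `Γ'' ++ [x]` would not suffice: a consumed `y` could be bound anew
      -- by this `let`, to a value that the function has not captured.
      · have hy' := hl f (hsub f (hmem hf (by simp [hσ]))) τ₁ Δ τ₂ hσ y hy
        have hy'' := hsub₁.subset hy'
        rw [Function.update_of_ne (hne hy''), Function.update_of_ne (hne hy'')]
        exact ⟨rfl, hcode y hy''⟩
  refine ((ih₂ hpre).map_left ?_).congr (fun _ => Iff.rfl) fun q => ?_
  · rintro (⟨u₂, R₂, H₂⟩ | _) (W₂ | _) hQ
    case ok.fail | fail.ok => exact hQ.elim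
    case fail.fail => trivial
    obtain ⟨z₂, w₂, F₂, G₂, extra₂, rfl, hfin₂, hR₂, hu₂, hst₂, hG₂, hcode₂, hfr₂⟩ := hQ
    have hmem {y : Var} (hy : y ∈ TEnv.erase Γ' x) : y ∈ Γ' ∧ y ≠ x := TEnv.mem_erase.1 hy
    -- The target never drops `x` from the packed store; as `x` was bound last, its components come
    -- after those of the final environment and count as surplus.
    refine ⟨z₂, w₂, F₂, G₂, TEnv.comps Γ₁ w₂ ++ extra₂, ?_, hfin₂, fun y hy => ?_, hu₂, ?_,
      fun y hy => hG₂ y (hmem hy).1, fun y hy => ?_, ?_⟩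
    · conv_lhs => rw [hΓ₁]
      simp only [TEnv.comps, List.flatMap_append, List.append_assoc]
    · change Env.erase R₂ x y = _
      rw [Env.erase, Function.update_of_ne (hmem hy).2, hR₂ y (hmem hy).1,
        Function.update_of_ne (hmem hy).2]
    · exact (hst₂.subset fun y hy => (hmem hy).1).congr
        (fun y hy => by rw [Function.update_of_ne (hmem hy).2]) (fun _ _ => rfl) fun _ _ => rfl
    · have := hcode₂ y (hmem hy).1
      rw [Function.update_of_ne (hmem hy).2] at this
      exact this.trans (hcode y (hsub₁.subset hy))
    · rw [footprint_append_update hx''] at hfr₂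
      refine (hfr.trans hfr₂ subset_rfl).mono subset_rfl ?_
      exact Set.union_subset_union_right _ (footprint_mono fun y hy => (hmem hy).1)
  · refine (ev_split₂ (PEnv.set_same _ _ _) (by simp)).trans
      (ev_unpack (w := w') (extra := extra) hnd'' (PEnv.set_same _ _ _) fun y hy => ?_)
    refine ⟨w y, ?_, hcode y hy⟩
    rw [PEnv.set_ne _ (by simp), PEnv.set_ne _ (by simpa using hne hy), PEnv.set_ne _ (by simp),
      h.tgt y (hsub y hy)]

theorem Pre.sim_ite (h : Pre Γ H R S v w F) {x : Var} {τ : NTy} {M₁ M₂ : Term L}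
    {N₁ N₂ : PTerm L} (hx : Γ.Has x (.n .b))
    (ih₁ : Sim (M₁.ev call R H) (N₁.ev pcall S) (Post Γ τ Γ' H v w F))
    (ih₂ : Sim (M₂.ev call R H) (N₂.ev pcall S) (Post Γ τ Γ' H v w F)) :
    Sim ((Term.ite x M₁ M₂).ev call R H) ((PTerm.ite (.src x) N₁ N₂).ev pcall S)
      (Post Γ τ Γ' H v w F) := by
  obtain ⟨c, hv, hw⟩ := (h.store.val x hx.1 _ hx.2).exists_const
  have hs := h.src x hx.1
  have ht := h.tgt x hx.1
  rw [hv] at hs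
  rw [hw] at ht
  by_cases hc : L.base.Truthy c
  · exact ih₁.congr (fun a => by simp [Term.ev, hs, hc]) fun p => by simp [PTerm.ev, ht, hc]
  · exact ih₂.congr (fun a => by simp [Term.ev, hs, hc]) fun p => by simp [PTerm.ev, ht, hc]

theorem Pre.ev_app (h : Pre Γ H R S v w F) {f x : Var} (hf : f ∈ Γ) (hx : x ∈ Γ) (a : Ans L) :
    (Term.app f x).ev call R H a ↔
      ∃ a₁, call (v f) (v x) H a₁ ∧ a = a₁.mapEnv fun _ => R := by
  simp [Term.ev, h.src f hf, h.src x hx]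

/-- A call only borrows `f` and `x`: the target gets back the argument and the store of `f`, both
possibly changed, and the source values of both variables stay the same. Everything else in `Γ` is
framed. -/
theorem Pre.sim_app (h : Pre Γ H R S v w F) (hcall : CallSim call pcall) {f x : Var} {τ₁ τ₂ : NTy}
    {m : ℕ} (hf : Γ.Has f (.n (.fn τ₁ m τ₂))) (hx : Γ.Has x (.n τ₁)) :
    Sim ((Term.app f x).ev call R H)
      ((letTriple .r (.src x) .h
          (.letE .code (codeOf f) (.app .code (pair (PTerm.v x) (envOf f))))
          (.letE (.src f) (closure (codeOf f) (.var .h)) (pair (.var .r) (pack Γ)))).ev pcall S)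
      (Post Γ τ₂ Γ H v w F) := by
  have hfx : f ≠ x := by
    rintro rfl
    have := hf.2.symm.trans hx.2
    simp only [FTy.n.injEq] at this
    have := congrArg sizeOf this
    simp only [NTy.fn.sizeOf_spec] at this
    omega
  have hvf := h.store.val f hf.1 _ hf.2
  obtain ⟨Δ, R₀, c, S₀, v₀, w₀, F₀, rfl, hc, hR₀, hst₀, hwf, hFf⟩ := hvf.exists_of_fn
  have htf := h.tgt f hf.1
  rw [hwf] at htf
  have hsep : ∀ y ∈ Δ.toTEnv, Disjoint (F x) (F₀ y) := fun y hy =>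
    (h.store.sep x hx.1 f hf.1 hfx.symm).mono_right (by rw [hFf]; exact subset_footprint hy)
  refine ((hcall h.fin hc hR₀ hst₀ (h.store.val x hx.1 _ hx.2) hsep).bind
    (E' := fun a₁ a => a = a₁.mapEnv fun _ => R) ?_).congr (h.ev_app hf.1 hx.1)
    fun p => PTerm.ev_letE.trans (exists_congr fun p₁ => and_congr_left' ?_)
  swap
  · have ht : S.set .code c (.src f) = _ := (PEnv.set_ne _ (by simp) _).trans htf
    exact (ev_letE_of_returns (returns_codeOf htf)).trans (ev_app_of_returns (PEnv.set_same _ _ _)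
      (returns_pair (returns_var ((PEnv.set_ne _ (by simp) _).trans (h.tgt x hx.1)))
        (returns_envOf ht)))
  rintro (⟨u, R', H'⟩ | _) (W | _) hQ
  case ok.fail | fail.ok => exact hQ.elim
  case fail.fail =>
    exact .of_unique (p := .fail) ⟨_, rfl⟩ (by rintro _ rfl; trivial) fun _ => Iff.rfl
  obtain ⟨z, z₁, w', G, G₁, F', rfl, hfin, hu, hu₁, hst, hGG, hG, hG₁, hcx, hcode, hfr⟩ := hQ
  -- The code still refers to the environment captured at definition time, which agrees with the new
  -- values up to store components.
  have hvf' : VRel H' (.fn τ₁ Δ.size τ₂) (v f) (.closure (Δ.toTEnv.comps w') c)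
      (footprint Δ.toTEnv F') := by
    refine .fn hc (fun y hy => ?_) hst.val hst.sep
    obtain ⟨h₁, w₁, h₂, h₃⟩ := hR₀ y hy
    exact ⟨h₁, w₁, h₂, (hcode y hy).trans h₃⟩
  have hGf : Disjoint G (footprint Δ.toTEnv F') :=
    Set.disjoint_right.2 fun ℓ ⟨y, hy, hℓ⟩ => Set.disjoint_right.1 (hG y hy) hℓ
  have hG₁f : Disjoint G₁ (footprint Δ.toTEnv F') :=
    Set.disjoint_right.2 fun ℓ ⟨y, hy, hℓ⟩ => Set.disjoint_right.1 (hG₁ y hy) hℓ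
  set wf := Function.update w f (.closure (Δ.toTEnv.comps w') c) with hwf_def
  set Ff := Function.update F f (footprint Δ.toTEnv F') with hFf_def
  have hst_f : StoreRel H' [f] v wf Ff := by
    refine ⟨fun y hy τ hτ => ?_, fun y hy _ _ _ hσ => ?_, fun y hy y' hy' hne => ?_⟩
    · obtain rfl := List.mem_singleton.1 hy
      obtain rfl : _ = τ := by simpa using hf.2.symm.trans hτ
      rw [hwf_def, hFf_def, Function.update_self, Function.update_self]
      exact hvf'
    · obtain rfl := List.mem_singleton.1 hy
      cases hf.2.symm.trans hσ
    · exact absurd ((List.mem_singleton.1 hy).trans (List.mem_singleton.1 hy').symm) hne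
  have hxf : x ∉ [f] := by simpa using hfx.symm
  have hst_T := hst_f.update_append hxf (u := v x) (z := z₁) (G := G₁)
    (fun τ hτ => by
      obtain rfl : _ = τ := by simpa using hx.2.symm.trans hτ
      exact hu₁)
    (fun _ _ _ hσ => by cases hx.2.symm.trans hσ)
    (fun y hy => by
      obtain rfl := List.mem_singleton.1 hy
      rw [hFf_def, Function.update_self]
      exact hG₁f)
  rw [Function.update_eq_self] at hst_T
  have hframe := h.store.frame (T := [f] ++ [x]) (G := G)
    (by
      rintro y hy
      rcases List.mem_append.1 hy with hy | hy <;> obtain rfl := List.mem_singleton.1 hy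
      exacts [hf.1, hx.1]) hst_T
    (fun y _ hyT => by
      simp only [List.mem_append, List.mem_singleton, not_or] at hyT
      simp [hwf_def, hFf_def, hyT.1, hyT.2])
    (by
      rw [footprint_append_update hxf, footprint_append, footprint_singleton, footprint_singleton,
        footprint_singleton, hFf_def, Function.update_self, hFf, Set.union_comm _ (F x),
        ← Set.union_assoc]
      exact hfr)
    (by
      rintro y hy
      rcases List.mem_append.1 hy with hy | hy <;> obtain rfl := List.mem_singleton.1 hy
      · rw [Function.update_of_ne hfx, hFf_def, Function.update_self]
        exact hGf
      · rw [Function.update_self]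
        exact hGG)
  obtain ⟨hst', hG', hfr'⟩ := hframe
  refine .of_unique ⟨_, rfl⟩ (p := .ok (.tuple ![z, .tup (Γ.comps (Function.update wf x z₁))])) ?_
    fun q => ?_
  · rintro _ rfl
    refine ⟨z, _, _, G, [], by rw [List.append_nil], hfin, h.src, hu, hst', hG', fun y hy => ?_,
      hfr'⟩
    by_cases hyx : y = x
    · subst hyx
      rw [Function.update_self, hx.2]
      exact hcx
    · rw [Function.update_of_ne hyx, hwf_def]
      by_cases hyf : y = f
      · subst hyf
        rw [Function.update_self, hf.2, hwf]
        have h₁ := hvf.length_comps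
        have h₂ := hvf'.length_comps
        rw [hwf] at h₁
        simp only [FTy.comps, PVal.store_closure, NTy.size] at h₁ h₂
        exact ⟨_, _, c, rfl, rfl, h₂, h₁⟩
      · rw [Function.update_of_ne hyf]
        exact (h.store.shaped y hy).sameCode_refl
  · refine (ev_split₃ (PEnv.set_same _ _ _) (by simp) (by simp)).trans ?_
    refine (ev_letE_of_returns (w := .closure (Δ.toTEnv.comps w') c)
      (returns_closure (returns_codeOf (us := Δ.toTEnv.comps w₀) ?_)
        (returns_var (PEnv.set_same _ _ _)))).trans
      (returns_pair (returns_var ?_) (PTerm.returns_pack (fun y hy => ?_) hst'.shaped) q)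
    · rw [PEnv.set_ne _ (by simp), PEnv.set_ne _ (by simpa using hfx), PEnv.set_ne _ (by simp),
        PEnv.set_ne _ (by simp), htf]
    · rw [PEnv.set_ne _ (by simp), PEnv.set_ne _ (by simp), PEnv.set_ne _ (by simp),
        PEnv.set_same]
    · by_cases hyf : y = f
      · subst hyf
        rw [PEnv.set_same, Function.update_of_ne hfx, hwf_def, Function.update_self]
      · rw [PEnv.set_ne _ (by simpa using hyf), PEnv.set_ne _ (by simp)]
        by_cases hyx : y = x
        · subst hyx
          rw [PEnv.set_same, Function.update_self]
        · rw [PEnv.set_ne _ (by simpa using hyx), PEnv.set_ne _ (by simp),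
            PEnv.set_ne _ (by simp), Function.update_of_ne hyx, hwf_def,
            Function.update_of_ne hyf, h.tgt y hy]

/-- Here the store of `f` is that of the current variables of `Δ`, so the call borrows `Δ` and `x`
from `Γ`. The argument must not be among the captured variables, or its cells would be passed twice.
-/
theorem Pre.sim_rapp (h : Pre Γ H R S v w F) (hcall : CallSim call pcall) (hnd : Γ.Nodup)
    {f x : Var} {τ₁ τ₂ : NTy} {Δ : NTEnv} (hf : Γ.Has f (.rfun τ₁ Δ τ₂)) (hx : Γ.Has x (.n τ₁))
    (hΔ : Δ.toTEnv.Sublist ((Γ.erase f).erase x)) :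
    Sim ((Term.app f x).ev call R H)
      ((PTerm.letE .h (pack Δ.toTEnv)
          (letTriple .r (.src x) .h (.app (.src f) (pair (PTerm.v x) (.var .h)))
            (unpack Δ.toTEnv (pair (.var .r) (pack Γ))))).ev pcall S)
      (Post Γ τ₂ Γ H v w F) := by
  have hΔΓ : ∀ y ∈ Δ.toTEnv, y ∈ Γ := fun y hy =>
    (TEnv.mem_erase.1 (TEnv.mem_erase.1 (hΔ.subset hy)).1).1
  have hxΔ : x ∉ Δ.toTEnv := fun hm => (TEnv.mem_erase.1 (hΔ.subset hm)).2 rfl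
  have hndΔ : Δ.toTEnv.Nodup :=
    hnd.sublist (hΔ.trans ((TEnv.erase_sublist _ _).trans (TEnv.erase_sublist _ _)))
  obtain ⟨R₀, S₀, hc, hR₀⟩ := h.funs f hf.1 _ _ _ hf.2
  have hst₀ := h.store.subset hΔΓ
  have hsep : ∀ y ∈ Δ.toTEnv, Disjoint (F x) (F y) := fun y hy =>
    h.store.sep x hx.1 y (hΔΓ y hy) fun e => hxΔ (e ▸ hy)
  refine ((hcall h.fin hc hR₀ hst₀ (h.store.val x hx.1 _ hx.2) hsep).bind
    (E' := fun a₁ a => a = a₁.mapEnv fun _ => R) ?_).congr (h.ev_app hf.1 hx.1)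
    fun p => (ev_letE_of_returns (h.returns_pack hΔΓ)).trans
      (PTerm.ev_letE.trans (exists_congr fun p₁ => and_congr_left' ?_))
  swap
  · exact ev_app_of_returns ((PEnv.set_ne _ (by simp) _).trans (h.tgt f hf.1))
      (returns_pair (returns_var ((PEnv.set_ne _ (by simp) _).trans (h.tgt x hx.1)))
        (returns_var (PEnv.set_same _ _ _)))
  rintro (⟨u, R', H'⟩ | _) (W | _) hQ
  case ok.fail | fail.ok => exact hQ.elim
  case fail.fail =>
    exact .of_unique (p := .fail) ⟨_, rfl⟩ (by rintro _ rfl; trivial) fun _ => Iff.rfl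
  obtain ⟨z, z₁, w', G, G₁, F', rfl, hfin, hu, hu₁, hst, hGG, hG, hG₁, hcx, hcode, hfr⟩ := hQ
  have hst_T := hst.update_append hxΔ (u := v x) (z := z₁) (G := G₁)
    (fun τ hτ => by
      obtain rfl : _ = τ := by simpa using hx.2.symm.trans hτ
      exact hu₁)
    (fun _ _ _ hσ => by cases hx.2.symm.trans hσ) hG₁
  rw [Function.update_eq_self] at hst_T
  have hne {y : Var} (hy : y ∈ Δ.toTEnv) : y ≠ x := fun e => hxΔ (e ▸ hy)
  -- The call determines `w'` and `F'` only on `Δ`; elsewhere the values from before the call are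
  -- kept.
  let w₁ : Var → PVal L := fun y => if y ∈ Δ.toTEnv ++ [x] then Function.update w' x z₁ y else w y
  let F₁ : Var → Set ℕ := fun y => if y ∈ Δ.toTEnv ++ [x] then Function.update F' x G₁ y else F y
  have hw₁x : w₁ x = z₁ := by simp [w₁]
  have hw₁Δ {y : Var} (hy : y ∈ Δ.toTEnv) : w₁ y = w' y := by simp [w₁, hy, hne hy]
  have hw₁ {y : Var} (hy : y ∉ Δ.toTEnv) (hyx : y ≠ x) : w₁ y = w y := by simp [w₁, hy, hyx]
  have hframe := h.store.frame (T := Δ.toTEnv ++ [x]) (G := G) (w' := w₁) (F' := F₁)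
    (by
      rintro y hy
      rcases List.mem_append.1 hy with hy | hy
      · exact hΔΓ y hy
      · obtain rfl := List.mem_singleton.1 hy
        exact hx.1)
    (hst_T.congr (fun _ _ => rfl) (fun y hy => if_pos hy) fun y hy => if_pos hy)
    (fun y _ hyT => ⟨if_neg hyT, if_neg hyT⟩)
    (by
      rw [footprint_congr (F := F₁) (F' := Function.update F' x G₁) fun y hy => if_pos hy,
        footprint_append_update hxΔ, footprint_append, footprint_singleton, Set.union_comm _ (F x),
        ← Set.union_assoc]
      exact hfr)
    (by
      rintro y hy
      rw [show F₁ y = _ from if_pos hy]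
      rcases List.mem_append.1 hy with hy | hy
      · rw [Function.update_of_ne (hne hy)]
        exact hG y hy
      · obtain rfl := List.mem_singleton.1 hy
        rw [Function.update_self]
        exact hGG)
  obtain ⟨hst', hG', hfr'⟩ := hframe
  refine .of_unique ⟨_, rfl⟩ (p := .ok (.tuple ![z, .tup (Γ.comps w₁)])) ?_ fun q => ?_
  · rintro _ rfl
    refine ⟨z, w₁, F₁, G, [], by rw [List.append_nil], hfin, h.src, hu, hst', hG', fun y hy => ?_,
      hfr'⟩
    by_cases hyx : y = x
    · subst hyx
      rw [hw₁x, hx.2]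
      exact hcx
    · by_cases hyΔ : y ∈ Δ.toTEnv
      · rw [hw₁Δ hyΔ]
        exact hcode y hyΔ
      · rw [hw₁ hyΔ hyx]
        exact (h.store.shaped y hy).sameCode_refl
  · refine (ev_split₃ (PEnv.set_same _ _ _) (by simp) (by simp)).trans
      ((ev_unpack (w := w') (extra := []) hndΔ ?_ fun y hy => ?_).trans
        (returns_pair (returns_var ?_) (PTerm.returns_pack (fun y hy => ?_) hst'.shaped) q))
    · rw [List.append_nil, PEnv.set_same]
    · refine ⟨w y, ?_, hcode y hy⟩
      rw [PEnv.set_ne _ (by simp), PEnv.set_ne _ (by simpa using hne hy), PEnv.set_ne _ (by simp),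
        PEnv.set_ne _ (by simp), PEnv.set_ne _ (by simp), h.tgt y (hΔΓ y hy)]
    · exact (PEnv.set_ne _ (by simp) _).trans ((PEnv.set_ne _ (by simp) _).trans
        (PEnv.set_same _ _ _))
    · by_cases hyΔ : y ∈ Δ.toTEnv
      · rw [PEnv.rebind_mem hyΔ, hw₁Δ hyΔ]
      · rw [PEnv.rebind_notMem hyΔ, PEnv.set_ne _ (by simp)]
        by_cases hyx : y = x
        · subst hyx
          rw [PEnv.set_same, hw₁x]
        · rw [PEnv.set_ne _ (by simpa using hyx), PEnv.set_ne _ (by simp),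
            PEnv.set_ne _ (by simp), PEnv.set_ne _ (by simp), hw₁ hyΔ hyx, h.tgt y hy]

end Compound

/-- A term and its translation have related outcomes in related states. -/
theorem Tr.sim {call : Val L → Val L → Heap L → Ans L → Prop}
    {pcall : PVal L → PVal L → PAns L → Prop} (hcall : CallSim call pcall) {Γ Γ' : TEnv}
    {M : Term L} {τ : NTy} {N : PTerm L} (h : Tr Γ M τ Γ' N) (hl : Live Γ Γ') {H : Heap L}
    {R : Env L} {S : PEnv L} {v : Var → Val L} {w : Var → PVal L} {F : Var → Set ℕ}
    (hp : Pre Γ H R S v w F) :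
    Sim (M.ev call R H) (N.ev pcall S) (Post Γ τ Γ' H v w F) := by
  induction h generalizing H R S v w F with
  | fail =>
    exact .of_unique (p := .fail) ⟨_, rfl⟩ (by rintro _ rfl; trivial) fun _ => ev_pair_fail
  | unit =>
    exact .of_unique ⟨_, rfl⟩ (by rintro _ rfl; exact hp.post_const .unit)
      (returns_pair (fun _ => Iff.rfl) (hp.returns_pack fun _ hx => hx))
  | @const Γ c =>
    exact .of_unique ⟨_, rfl⟩ (by rintro _ rfl; exact hp.post_const (.const c))
      (returns_pair (fun _ => Iff.rfl) (hp.returns_pack fun _ hx => hx))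
  | var _ hx => exact hp.sim_var hx
  | op _ hxs => exact hp.sim_op hxs
  | deref _ hx => exact hp.sim_deref hx
  | mkref _ hx => exact hp.sim_mkref hx
  | assign _ hy hx => exact hp.sim_assign hy hx
  | @letE Γ Γ' Γ'' x τ τ' M₁ M₂ N₁ N₂ hx h₁ h₂ ih₁ ih₂ =>
    have hsub := (TEnv.eq_erase_append (TEnv.notMem_of_nodup_append h₂.wf.1) h₂.sublist).1
    refine hp.sim_let hx (fun y hy => h₁.sublist.subset hy) h₂.wf.1 h₂.sublist hl
      (ih₁ (fun f hf τ₁ Δ τ₂ hσ y hy => hsub.subset (hl f hf τ₁ Δ τ₂ hσ y hy)) hp)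
      fun hp' => ih₂ (fun f hf τ₁ Δ τ₂ hσ y hy => ?_) hp'
    rcases List.mem_append.1 hf with hf | hf
    · exact (TEnv.mem_erase.1 (hl f (h₁.sublist.subset hf) τ₁ Δ τ₂ hσ y hy)).1
    · rw [List.mem_singleton.1 hf] at hσ
      cases hx.symm.trans hσ
  | ite hx _ _ ih₁ ih₂ => exact hp.sim_ite hx (ih₁ hl hp) (ih₂ hl hp)
  | lam _ hx h hs =>
    exact hp.sim_fun hs (.lam hx h) (fun _ => Iff.rfl) fun _ => Iff.rfl
  | fix _ hf hx h hs =>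
    exact hp.sim_fun hs (.fix hf hx h) (fun _ => Iff.rfl) fun _ => Iff.rfl
  | app _ hf hx => exact hp.sim_app hcall hf hx
  | rapp wf hf hx hΔ => exact hp.sim_rapp hcall wf.1 hf hx hΔ

/-! ### Simulation of calls -/

/-- The code of a translated function packs its results like the source function. -/
theorem sim_funBody {call : Val L → Val L → Heap L → Ans L → Prop}
    {pcall : PVal L → PVal L → PAns L → Prop} (hcall : CallSim call pcall) {Δ : NTEnv} {Θ : TEnv}
    {y : Var} {τ₁ τ₂ : NTy} {M : Term L} {N : PTerm L} (hN : Tr Θ M τ₂ Θ N)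
    (hΔ : Δ.toTEnv.Sublist Θ) (hy : Θ.Has y (.n τ₁)) (hyΔ : y ∉ Δ.toTEnv)
    {H : Heap L} {R : Env L} {S : PEnv L} {v v' : Var → Val L} {w w' : Var → PVal L}
    {F F' : Var → Set ℕ} (hv : ∀ x ∈ Δ.toTEnv, v' x = v x ∧ w' x = w x ∧ F' x = F x)
    (hF : ∀ x ∈ Θ, x ∈ Δ.toTEnv ∨ x = y ∨ F' x = ∅)
    (hp : S .p = some (.tuple ![w' y, .tup (Δ.toTEnv.comps w)]))
    (hS : ∀ x ∈ Δ.toTEnv, ∃ w₀, S (.src x) = some w₀ ∧ x.ty.SameCode (w x) w₀)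
    (hpre : Pre Θ H R (((S.set (.src y) (w' y)).set .h (.tup (Δ.toTEnv.comps w))).rebind
      Δ.toTEnv w) v' w' F') :
    Sim (M.ev call R H) ((funBody Δ.toTEnv Θ y N).ev pcall S)
      (CallPost τ₁ Δ τ₂ H v w F (v' y) (w' y) (F' y)) := by
  have hne {x : Var} (hx : x ∈ Δ.toTEnv) : x ≠ y := fun e => hyΔ (e ▸ hx)
  have hndΘ := hN.wf.1
  -- A body ends in the environment in which it starts, so well-formedness says that the variables
  -- captured by a recursive function are never consumed.
  have hsim := hN.sim hcall (fun f hf τ₁ Δ τ₂ hσ x hx =>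
    (hN.wf.2 f hf τ₁ Δ τ₂ hσ).subset hx) hpre
  set S₁ := ((S.set (.src y) (w' y)).set .h (.tup (Δ.toTEnv.comps w))).rebind Δ.toTEnv w
  have hev (p : PAns L) : (funBody Δ.toTEnv Θ y N).ev pcall S p ↔ ∃ p₁, N.ev pcall S₁ p₁ ∧
      p₁.cont (fun W => (split₂ .r .h (unpack Θ (triple (.var .r) (PTerm.v y)
        (pack Δ.toTEnv)))).ev pcall (S₁.set .p W)) p := by
    refine (ev_split₂ hp (by simp)).trans ((ev_unpack (w := w) (extra := [])
      (hndΘ.sublist hΔ) ?_ fun x hx => ?_).trans PTerm.ev_letE)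
    · rw [List.append_nil, PEnv.set_same]
    · rw [PEnv.set_ne _ (by simp), PEnv.set_ne _ (by simpa using hne hx)]
      exact hS x hx
  refine (hsim.bind_right ?_).congr (fun _ => Iff.rfl) hev
  rintro (⟨u, R', H'⟩ | _) (W | _) hQ
  case ok.fail | fail.ok => exact hQ.elim
  case fail.fail => exact ⟨.fail, trivial, fun _ => Iff.rfl⟩
  obtain ⟨z, w₁, F₁, G, extra, rfl, hfin, hR, hu, hst, hG, hcode, hfr⟩ := hQ
  refine ⟨.ok (.tuple ![z, w₁ y, .tup (Δ.toTEnv.comps w₁)]), ?_, fun q => ?_⟩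
  · refine ⟨z, w₁ y, w₁, G, F₁ y, F₁, rfl, hfin, hu, hst.val y hy.1 τ₁ hy.2,
      (hst.subset fun x hx => hΔ.subset hx).congr (fun x hx => (hv x hx).1.symm)
        (fun _ _ => rfl) (fun _ _ => rfl), hG y hy.1, fun x hx => hG x (hΔ.subset hx),
      fun x hx => hst.sep y hy.1 x (hΔ.subset hx) (hne hx).symm, ?_, fun x hx => ?_,
      hfr.mono ?_ ?_⟩
    · have := hcode y hy.1
      rwa [hy.2] at this
    · rw [← (hv x hx).2.1]
      exact hcode x (hΔ.subset hx)
    · rintro ℓ ⟨x, hx, hℓ⟩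
      -- The third case is the recursive function itself, which owns nothing in its own body.
      rcases hF x hx with hx' | rfl | he
      · exact .inr ⟨x, hx', (hv x hx').2.2 ▸ hℓ⟩
      · exact .inl hℓ
      · rw [he] at hℓ
        exact hℓ.elim
    · rintro ℓ ((hℓ | hℓ) | ⟨x, hx, hℓ⟩)
      exacts [.inl hℓ, .inr ⟨y, hy.1, hℓ⟩, .inr ⟨x, hΔ.subset hx, hℓ⟩]
  · refine (ev_split₂ (PEnv.set_same _ _ _) (by simp)).trans
      ((ev_unpack (w := w₁) (extra := extra) hndΘ (PEnv.set_same _ _ _) fun x hx => ?_).trans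
        (returns_triple (returns_var ?_) (returns_var (PEnv.rebind_mem hy.1))
          (PTerm.returns_pack (fun x hx => PEnv.rebind_mem (hΔ.subset hx))
            fun x hx => hst.shaped x (hΔ.subset hx)) q))
    · refine ⟨w' x, ?_, hcode x hx⟩
      rw [PEnv.set_ne _ (by simp), PEnv.set_ne _ (by simp), PEnv.set_ne _ (by simp),
        hpre.tgt x hx]
    · exact (PEnv.set_ne _ (by simp) _).trans (PEnv.set_same _ _ _)

theorem FunsRel.of_normal {Γ : TEnv} {v : Var → Val L} {w : Var → PVal L}
    (h : ∀ x ∈ Γ, ∃ τ, x.ty = .n τ) : FunsRel Γ v w := fun f hf _ _ _ hσ => by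
  obtain ⟨τ, hτ⟩ := h f hf
  cases hτ.symm.trans hσ

/-- A call of depth `k + 1` runs the body with calls of depth `k`, which `sim_funBody` simulates
once the captured store and the argument are assembled into a precondition. For `fix`, the function
joins this environment with an empty footprint. -/
theorem CallSim.succ {k : ℕ} (hcall : CallSim (L := L) (Val.call k) (PVal.call k)) :
    CallSim (L := L) (Val.call (k + 1)) (PVal.call (k + 1)) := by
  intro τ₁ Δ τ₂ u R c S v w F u₁ z₁ G₁ H hfin hc hR hst hu₁ hG₁
  cases hc with
  | @lam y M N _ _ hy hN =>
    have hyΔ := TEnv.notMem_of_nodup_append hN.wf.1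
    have hne {x : Var} (hx : x ∈ Δ.toTEnv) : x ≠ y := fun e => hyΔ (e ▸ hx)
    have := sim_funBody hcall hN (R := Env.set R y u₁)
      (S := S.set .p (.tuple ![z₁, .tup (Δ.toTEnv.comps w)]))
      (v := v) (w := w) (F := F) (H := H) (v' := Function.update v y u₁)
      (w' := Function.update w y z₁) (F' := Function.update F y G₁) (τ₁ := τ₁)
      (List.sublist_append_left _ _) ⟨by simp, hy⟩ hyΔ
      (fun x hx => by simp [hne hx]) (fun x hx => by
        simp only [List.mem_append, List.mem_singleton] at hx
        tauto)
      (by rw [PEnv.set_same, Function.update_self])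
      (fun x hx => by
        rw [PEnv.set_ne _ (by simp)]
        exact (hR x hx).2)
      ⟨hfin, fun x hx => ?_, fun x hx => ?_, hst.update_append hyΔ ?_ ?_ hG₁,
        FunsRel.of_normal fun x hx => ?_⟩
    · simp only [Function.update_self] at this
      exact this
    · rcases List.mem_append.1 hx with hx | hx
      · rw [Env.set, Function.update_of_ne (hne hx), Function.update_of_ne (hne hx), (hR x hx).1]
      · obtain rfl := List.mem_singleton.1 hx
        rw [Env.set, Function.update_self, Function.update_self]
    · rcases List.mem_append.1 hx with hx | hx
      · rw [PEnv.rebind_mem hx, Function.update_of_ne (hne hx)]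
      · obtain rfl := List.mem_singleton.1 hx
        rw [PEnv.rebind_notMem hyΔ, PEnv.set_ne _ (by simp), PEnv.set_same]
    · intro τ hτ
      obtain rfl : τ₁ = τ := by simpa using hy.symm.trans hτ
      exact hu₁
    · intro _ _ _ hσ
      cases hy.symm.trans hσ
    · rcases List.mem_append.1 hx with hx | hx
      · exact NTEnv.exists_ty_of_mem hx
      · exact ⟨τ₁, List.mem_singleton.1 hx ▸ hy⟩
  | @fix f y M N _ _ hf hy hN =>
    set u : Val L := .rclos f y M R with hu
    set c : PVal L := .rclos (.src f) .p (funBody Δ.toTEnv (Δ.toTEnv ++ [f, y]) y N) S with hc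
    have hΘ : Δ.toTEnv ++ [f, y] = (Δ.toTEnv ++ [f]) ++ [y] := by simp
    have hyΔf : y ∉ Δ.toTEnv ++ [f] := TEnv.notMem_of_nodup_append (hΘ ▸ hN.wf.1)
    have hfΔ : f ∉ Δ.toTEnv :=
      TEnv.notMem_of_nodup_append (List.nodup_append.1 (hΘ ▸ hN.wf.1)).1
    have hyΔ : y ∉ Δ.toTEnv := fun h => hyΔf (List.mem_append_left _ h)
    have hfy : f ≠ y := fun e => hyΔf (by simp [e])
    have hne {x : Var} (hx : x ∈ Δ.toTEnv) : x ≠ y := fun e => hyΔ (e ▸ hx)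
    have hnf {x : Var} (hx : x ∈ Δ.toTEnv) : x ≠ f := fun e => hfΔ (e ▸ hx)
    have hmem {x : Var} (hx : x ∈ Δ.toTEnv ++ [f, y]) : x ∈ Δ.toTEnv ∨ x = f ∨ x = y := by
      simpa using hx
    have hval {x : Var} (hx : x ∈ Δ.toTEnv) :
        Function.update (Function.update v f u) y u₁ x = v x ∧
        Function.update (Function.update w f c) y z₁ x = w x ∧
        Function.update (Function.update F f ∅) y G₁ x = F x := by simp [hne hx, hnf hx]
    have := sim_funBody hcall hN (R := Env.set (Env.set R f u) y u₁)
      (S := (S.set (.src f) c).set .p (.tuple ![z₁, .tup (Δ.toTEnv.comps w)]))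
      (v := v) (w := w) (F := F) (H := H) (v' := Function.update (Function.update v f u) y u₁)
      (w' := Function.update (Function.update w f c) y z₁)
      (F' := Function.update (Function.update F f ∅) y G₁) (τ₁ := τ₁)
      (List.sublist_append_left _ _) ⟨by simp, hy⟩ hyΔ (fun x hx => hval hx)
      (fun x hx => by
        rcases hmem hx with hx | rfl | rfl
        · exact .inl hx
        · simp [hfy]
        · simp)
      (by rw [PEnv.set_same, Function.update_self])
      (fun x hx => by
        rw [PEnv.set_ne _ (by simp), PEnv.set_ne _ (by simpa using hnf hx)]
        exact (hR x hx).2)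
      ⟨hfin, fun x hx => ?_, fun x hx => ?_, ?_, ?_⟩
    · simp only [Function.update_self] at this
      exact this
    · rcases hmem hx with hx | rfl | rfl
      · rw [(hval hx).1, Env.set, Function.update_of_ne (hne hx), Env.set,
          Function.update_of_ne (hnf hx), (hR x hx).1]
      · simp [Env.set, hfy]
      · simp [Env.set]
    · rcases hmem hx with hx | rfl | rfl
      · rw [PEnv.rebind_mem hx, (hval hx).2.1]
      · rw [PEnv.rebind_notMem hfΔ, PEnv.set_ne _ (by simp), PEnv.set_ne _ (by simpa using hfy),
          PEnv.set_ne _ (by simp), PEnv.set_same, Function.update_of_ne hfy, Function.update_self]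
      · rw [PEnv.rebind_notMem hyΔ, PEnv.set_ne _ (by simp), PEnv.set_same]
    · rw [hΘ]
      refine (hst.update_append hfΔ (u := u) (z := c) (G := ∅) ?_ (fun _ _ _ _ => rfl)
        fun _ _ => Set.empty_disjoint _).update_append hyΔf ?_ ?_ fun x hx => ?_
      · intro τ hτ
        cases hf.symm.trans hτ
      · intro τ hτ
        obtain rfl : τ₁ = τ := by simpa using hy.symm.trans hτ
        exact hu₁
      · intro _ _ _ hσ
        cases hy.symm.trans hσ
      · rcases List.mem_append.1 hx with hx | hx
        · rw [Function.update_of_ne (hnf hx)]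
          exact hG₁ x hx
        · rw [List.mem_singleton.1 hx, Function.update_self]
          exact Set.disjoint_empty _
    · intro g hg τ₁' Δ' τ₂' hσ
      rcases hmem hg with hg | rfl | rfl
      · obtain ⟨τ, hτ⟩ := NTEnv.exists_ty_of_mem hg
        cases hτ.symm.trans hσ
      -- The environments that witness `FunsRel` for `f` are those of the closure being called.
      · cases hf.symm.trans hσ
        refine ⟨R, S, ?_, fun x hx => ?_⟩
        · rw [Function.update_of_ne hfy, Function.update_self, Function.update_of_ne hfy,
            Function.update_self]
          exact .fix hf hy hN
        · rw [(hval hx).1, (hval hx).2.1]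
          exact hR x hx
      · cases hy.symm.trans hσ

/-- At depth zero no call has an outcome on either side. -/
theorem callSim (k : ℕ) : CallSim (L := L) (Val.call k) (PVal.call k) := by
  induction k with
  | zero =>
    intro _ _ _ u _ c _ _ _ _ _ _ _ _ _ hc _ _ _ _
    cases hc <;> exact ⟨fun _ h => h.elim, fun _ h => h.elim⟩
  | succ k ih => exact ih.succ

end LinRef

/-! ### The equivalence for closed programs -/

open LinRef in
theorem mainTheorem1 (L : Lang) (M : Term L) (τ : NTy) (hτ : τ.IsBase) (N : PTerm L)
    (h : Tr [] M τ [] N) :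
    Eval M Env.empty Heap.empty .fail ↔ PEval N PEnv.empty .fail := by
  rw [eval_iff_exists_ev, pEval_iff_exists_ev]
  -- The same depth bound works on both sides, as source and target calls correspond one to one.
  refine exists_congr fun k => ?_
  have hp : Pre [] (Heap.empty (L := L)) Env.empty PEnv.empty (fun _ => .atom .unit)
      (fun _ => .unit) (fun _ => ∅) :=
    ⟨by simp [Heap.IsFinite, Heap.empty], by simp, by simp,
      ⟨by simp, by simp, by simp [Separate]⟩, by simp [FunsRel]⟩
  have hsim := h.sim (callSim k) (by simp [Live]) hp
  constructor
  · intro he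
    obtain ⟨p, hp, hQ⟩ := hsim.1 _ he
    cases p with
    | fail => exact hp
    | ok => exact hQ.elim
  · intro he
    obtain ⟨a, ha, hQ⟩ := hsim.2 _ he
    cases a with
    | fail => exact ha
    | ok => exact hQ.elim
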